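/- All semirings are commutative, with $0$ and $1$; a semiring $A$ is cancellative if $ba=ca$ with $a\neq 0$ implies $b=c$. For a semiring $A$, $\operatorname{Spec}A$ is the set of prime ideals with the Zariski topology and the sheaf of families of elements of the localizations $A_{\mathfrak p}$ that are locally given by fractions. A semiring scheme is a topological space with a sheaf of semirings $\mathcal O_X$ with local stalks that is locally isomorphic to some $\operatorname{Spec}A$; it is cancellative if $\mathcal O_X(U)$ is cancellative for every open $U$. Let $X$ be a nonempty cancellative semiring scheme. Then $X$ has a generic point $\eta$; let $K=\mathcal O_{X,\eta}$ be its function field and $\mathcal K$ the constant sheaf on $X$ associated to $K$, with the canonical map $\mathcal O_X\to\mathcal K$. Let $\mathrm{Cart}(X)=\Gamma(X,\mathcal K^\times/\mathcal O_X^\times)$ be the group of Cartier divisors, $P(X)$ the subgroup of principal Cartier divisors, i.e. those represented by a single element of $K^\times$, and $\mathrm{CaCl}(X)=\mathrm{Cart}(X)/P(X)$. Let $\mathrm{Pic}(X)$ be the set of isomorphism classes of invertible sheaves on $X$ (sheaves of $\mathcal O_X$-modules locally isomorphic to $\mathcal O_X$), with the operation induced by $\otimes_{\mathcal O_X}$.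 For a Cartier divisor $D$ represented by $\{(U_i,f_i)\}$ with $f_i\in\mathcal K^\times(U_i)$, let $\mathcal L(D)\subseteq\mathcal K$ be the subsheaf of $\mathcal O_X$-modules with $\mathcal L(D)|_{U_i}=f_i^{-1}\mathcal O_X|_{U_i}$. Then $\mathcal L(D)$ is an invertible sheaf for every $D\in\mathrm{Cart}(X)$, and $$\mathrm{CaCl}(X)\longrightarrow\mathrm{Pic}(X),\qquad [D]\longmapsto[\mathcal L(D)],$$ is a well-defined isomorphism of groups. -/

import Mathlib

open CategoryTheory TopologicalSpace Opposite

universe u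

noncomputable section

/-- A topological space with a sheaf of commutative semirings. -/
abbrev SemiringedSpace : Type (u + 1) := AlgebraicGeometry.SheafedSpace CommSemiRingCat.{u}

namespace SemiringedSpace

/-- The semiring `𝒪_X(U)`. -/
abbrev Sec (X : SemiringedSpace.{u}) (U : Opens X) : Type u := X.presheaf.obj (op U)

/-- The restriction homomorphism `𝒪_X(U) → 𝒪_X(V)` for `V ≤ U`. -/
def res (X : SemiringedSpace.{u}) {U V : Opens X} (h : V ≤ U) : X.Sec U →+* X.Sec V :=
  (X.presheaf.map (homOfLE h).op).hom

lemma res_self (X : SemiringedSpace.{u}) {U : Opens X} (h : U ≤ U) (s : X.Sec U) :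
    X.res h s = s :=
  congrArg (fun f => f.hom s) (X.presheaf.map_id (op U))

lemma res_res (X : SemiringedSpace.{u}) {U V W : Opens X} (h : V ≤ U) (h' : W ≤ V)
    (s : X.Sec U) : X.res h' (X.res h s) = X.res (h'.trans h) s :=
  (congrArg (fun f => f.hom s) (X.presheaf.map_comp (homOfLE h).op (homOfLE h').op)).symm

end SemiringedSpace

/-- Open neighbourhoods of a point, directed by reverse inclusion. -/
abbrev NhdIndex {X : Type u} [TopologicalSpace X] (x : X) : Type u := {U : Opens X // x ∈ U}ᵒᵈ

instance NhdIndex.nonempty {X : Type u} [TopologicalSpace X] (x : X) : Nonempty (NhdIndex x) :=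
  ⟨OrderDual.toDual ⟨⊤, trivial⟩⟩

instance NhdIndex.isDirected {X : Type u} [TopologicalSpace X] (x : X) :
    IsDirectedOrder (NhdIndex x) :=
  ⟨fun U V => ⟨OrderDual.toDual ⟨(OrderDual.ofDual U).1 ⊓ (OrderDual.ofDual V).1,
    (OrderDual.ofDual U).2, (OrderDual.ofDual V).2⟩,
    (inf_le_left : (OrderDual.ofDual U).1 ⊓ (OrderDual.ofDual V).1 ≤ _),
    (inf_le_right : (OrderDual.ofDual U).1 ⊓ (OrderDual.ofDual V).1 ≤ _)⟩⟩

/-- The open set underlying an index. -/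
abbrev NhdIndex.opens {X : Type u} [TopologicalSpace X] {x : X} (U : NhdIndex x) : Opens X :=
  (OrderDual.ofDual U).1

lemma NhdIndex.opens_le {X : Type u} [TopologicalSpace X] {x : X} {U V : NhdIndex x}
    (h : U ≤ V) : V.opens ≤ U.opens := h

/-- An open neighbourhood as an index. -/
abbrev NhdIndex.mk {X : Type u} [TopologicalSpace X] {x : X} (U : Opens X) (hx : x ∈ U) :
    NhdIndex x := OrderDual.toDual ⟨U, hx⟩

namespace SemiringedSpace

instance directedSystem (X : SemiringedSpace.{u}) (x : X) :
    DirectedSystem (fun U : NhdIndex x => X.Sec U.opens)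
      (fun _ _ h => X.res (NhdIndex.opens_le h)) where
  map_self _ s := X.res_self _ s
  map_map _ _ _ _ _ s := X.res_res _ _ s

/-- The stalk `𝒪_{X,x}`, the filtered colimit of `𝒪_X(U)` over the open neighbourhoods of `x`. -/
abbrev Stalk (X : SemiringedSpace.{u}) (x : X) : Type u :=
  DirectLimit (fun U : NhdIndex x => X.Sec U.opens)
    (fun _ _ h => X.res (NhdIndex.opens_le h))

/-- The germ at `x` of a section on an open neighbourhood of `x`. -/
def germ (X : SemiringedSpace.{u}) {x : X} (U : Opens X) (hx : x ∈ U) :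
    X.Sec U →+* X.Stalk x where
  toFun s := ⟦⟨NhdIndex.mk U hx, s⟩⟧
  map_zero' := (DirectLimit.zero_def (NhdIndex.mk U hx)).symm
  map_one' := (DirectLimit.one_def (NhdIndex.mk U hx)).symm
  map_add' s t := (DirectLimit.add_def (G := fun U : NhdIndex x => X.Sec U.opens)
    (f := fun _ _ h => X.res (NhdIndex.opens_le h)) (NhdIndex.mk U hx) s t).symm
  map_mul' s t := (DirectLimit.mul_def (G := fun U : NhdIndex x => X.Sec U.opens)
    (f := fun _ _ h => X.res (NhdIndex.opens_le h)) (NhdIndex.mk U hx) s t).symm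

lemma germ_res (X : SemiringedSpace.{u}) {x : X} {U V : Opens X} (h : V ≤ U) (hx : x ∈ V)
    (s : X.Sec U) : X.germ V hx (X.res h s) = X.germ U (h hx) s :=
  (DirectLimit.eq_of_le (F := fun U : NhdIndex x => X.Sec U.opens)
    (f := fun _ _ h => X.res (NhdIndex.opens_le h)) ⟨NhdIndex.mk U (h hx), s⟩
    (NhdIndex.mk V hx) h).symm

lemma exists_germ_eq (X : SemiringedSpace.{u}) {x : X} (z : X.Stalk x) :
    ∃ (U : Opens X) (hx : x ∈ U) (s : X.Sec U), X.germ U hx s = z := by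
  obtain ⟨U, s, rfl⟩ := DirectLimit.exists_eq_mk _ z
  exact ⟨U.opens, (OrderDual.ofDual U).2, s, rfl⟩

lemma germ_eq_iff (X : SemiringedSpace.{u}) {x : X} {U : Opens X} (hx : x ∈ U) (s t : X.Sec U) :
    X.germ U hx s = X.germ U hx t ↔
      ∃ (V : Opens X) (h : V ≤ U), x ∈ V ∧ X.res h s = X.res h t := by
  constructor
  · intro h
    obtain ⟨V, h1, h2, h3⟩ := Quotient.exact h
    exact ⟨V.opens, h1, (OrderDual.ofDual V).2, h3⟩
  · rintro ⟨V, h, hxV, e⟩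
    rw [← X.germ_res h hxV, ← X.germ_res h hxV, e]

end SemiringedSpace

/-! ### Affine semiring schemes -/

namespace SemiringSpec

/-- The localizations `A_𝔭`. -/
abbrev Loc (A : CommSemiRingCat.{u}) (p : TopCat.of (PrimeSpectrum A)) : Type u :=
  Localization p.asIdeal.primeCompl

/-- Families of elements of the `A_𝔭` given by a single fraction `a / s`. -/
def isFraction (A : CommSemiRingCat.{u}) : TopCat.PrelocalPredicate (Loc A) where
  pred {U} f := ∃ a s : A, ∀ p : U, ∃ hs : s ∉ p.1.asIdeal, f p = Localization.mk a ⟨s, hs⟩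
  res := by
    rintro V U i f ⟨a, s, h⟩
    exact ⟨a, s, fun p => h ⟨p.1, i.le p.2⟩⟩

/-- Families of elements of the `A_𝔭` locally given by a fraction. -/
abbrev isLocallyFraction (A : CommSemiRingCat.{u}) : TopCat.LocalPredicate (Loc A) :=
  (isFraction A).sheafify

/-- The semiring of families `(s(𝔭))_{𝔭 ∈ U}`, `s(𝔭) ∈ A_𝔭`, that are locally fractions. -/
def sections (A : CommSemiRingCat.{u}) (U : Opens (TopCat.of (PrimeSpectrum A))) :
    Subsemiring (∀ p : U, Loc A p.1) where
  carrier := {f | (isLocallyFraction A).pred f}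
  zero_mem' := TopCat.PrelocalPredicate.sheafifyOf ⟨0, 1, fun p =>
    ⟨p.1.asIdeal.primeCompl.one_mem, (Localization.mk_zero _).symm⟩⟩
  one_mem' := TopCat.PrelocalPredicate.sheafifyOf ⟨1, 1, fun p =>
    ⟨p.1.asIdeal.primeCompl.one_mem, Localization.mk_one.symm⟩⟩
  add_mem' := by
    intro f g hf hg p
    obtain ⟨V, hV, i, a, s, h⟩ := hf p
    obtain ⟨W, hW, j, b, t, k⟩ := hg p
    refine ⟨V ⊓ W, ⟨hV, hW⟩, Opens.infLELeft _ _ ≫ i, s * b + t * a, s * t, fun q => ?_⟩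
    obtain ⟨hs, e⟩ := h ⟨q.1, q.2.1⟩
    obtain ⟨ht, e'⟩ := k ⟨q.1, q.2.2⟩
    exact ⟨q.1.asIdeal.primeCompl.mul_mem hs ht,
      (congrArg₂ (· + ·) e e').trans (Localization.add_mk _ _ _ _)⟩
  mul_mem' := by
    intro f g hf hg p
    obtain ⟨V, hV, i, a, s, h⟩ := hf p
    obtain ⟨W, hW, j, b, t, k⟩ := hg p
    refine ⟨V ⊓ W, ⟨hV, hW⟩, Opens.infLELeft _ _ ≫ i, a * b, s * t, fun q => ?_⟩
    obtain ⟨hs, e⟩ := h ⟨q.1, q.2.1⟩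
    obtain ⟨ht, e'⟩ := k ⟨q.1, q.2.2⟩
    exact ⟨q.1.asIdeal.primeCompl.mul_mem hs ht,
      (congrArg₂ (· * ·) e e').trans (Localization.mk_mul _ _ _ _)⟩

/-- The structure presheaf of `Spec A`. -/
def structurePresheaf (A : CommSemiRingCat.{u}) :
    TopCat.Presheaf CommSemiRingCat.{u} (TopCat.of (PrimeSpectrum A)) where
  obj U := CommSemiRingCat.of (sections A U.unop)
  map {U V} i := CommSemiRingCat.ofHom
    { toFun := fun f => ⟨fun p => f.1 ⟨p.1, i.unop.le p.2⟩,
        (isLocallyFraction A).res i.unop f.1 f.2⟩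
      map_zero' := rfl
      map_one' := rfl
      map_add' := fun _ _ => rfl
      map_mul' := fun _ _ => rfl }

lemma structurePresheaf_isSheaf (A : CommSemiRingCat.{u}) : (structurePresheaf A).IsSheaf :=
  (TopCat.Presheaf.isSheaf_iff_isSheaf_comp (forget CommSemiRingCat.{u}) _).2
    (TopCat.subpresheafToTypes.isSheaf (isLocallyFraction A))

/-- The affine semiring scheme `Spec A`: the set of prime ideals of `A` with the Zariski topology
and the sheaf of families of elements of the `A_𝔭` that are locally fractions. -/
def _root_.SemiringSpec (A : CommSemiRingCat.{u}) : SemiringedSpace.{u} where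
  carrier := TopCat.of (PrimeSpectrum A)
  presheaf := structurePresheaf A
  IsSheaf := structurePresheaf_isSheaf A

end SemiringSpec

/-- A semiring scheme: a topological space with a sheaf of commutative semirings whose stalks are
local, and which is locally isomorphic to an affine semiring scheme. (An isomorphism of semiringed
spaces induces isomorphisms on stalks, hence is automatically local.) -/
structure SemiringScheme extends AlgebraicGeometry.SheafedSpace CommSemiRingCat.{u} where
  isLocalRing_stalk : ∀ x : toSheafedSpace, IsLocalRing (SemiringedSpace.Stalk toSheafedSpace x)
  locally_affine : ∀ x : toSheafedSpace, ∃ U : Opens toSheafedSpace, x ∈ U ∧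
    ∃ A : CommSemiRingCat.{u},
      Nonempty (toSheafedSpace.restrict U.isOpenEmbedding ≅ SemiringSpec A)

/-- A cancellative semiring: every nonzero element is multiplicatively cancellable. -/
def IsCancellativeSemiring (A : Type u) [CommSemiring A] : Prop :=
  ∀ a : A, a ≠ 0 → ∀ b c : A, b * a = c * a → b = c

/-- A cancellative semiring scheme: `𝒪_X(U)` is cancellative for every open `U`. -/
class SemiringScheme.IsCancellative (X : SemiringScheme.{u}) : Prop where
  cancel : ∀ U : Opens X.toSheafedSpace,
    IsCancellativeSemiring (SemiringedSpace.Sec X.toSheafedSpace U)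

/-! ### Sheaves of modules over a semiringed space -/

open scoped TensorProduct

/-- A presheaf of `𝒪_X`-modules (semimodules over the sheaf of semirings `𝒪_X`). -/
structure OMod (X : SemiringedSpace.{u}) where
  presheaf : TopCat.Presheaf AddCommMonCat.{u} X
  module : ∀ U : Opens X, Module (X.Sec U) (presheaf.obj (op U))
  map_smul : ∀ {U V : Opens X} (h : V ≤ U) (a : X.Sec U) (m : presheaf.obj (op U)),
    (presheaf.map (homOfLE h).op).hom (a • m) =
      X.res h a • (presheaf.map (homOfLE h).op).hom m

namespace OMod

variable {X : SemiringedSpace.{u}}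

/-- The sections of `M` on `U`. -/
abbrev Sec (M : OMod X) (U : Opens X) : Type u := M.presheaf.obj (op U)

instance instModule (M : OMod X) (U : Opens X) : Module (X.Sec U) (M.Sec U) := M.module U

/-- Restriction of sections. -/
def res (M : OMod X) {U V : Opens X} (h : V ≤ U) : M.Sec U →+ M.Sec V :=
  (M.presheaf.map (homOfLE h).op).hom

lemma res_smul (M : OMod X) {U V : Opens X} (h : V ≤ U) (a : X.Sec U) (m : M.Sec U) :
    M.res h (a • m) = X.res h a • M.res h m := M.map_smul h a m

lemma res_self (M : OMod X) {U : Opens X} (h : U ≤ U) (s : M.Sec U) : M.res h s = s :=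
  congrArg (fun f => f.hom s) (M.presheaf.map_id (op U))

lemma res_res (M : OMod X) {U V W : Opens X} (h : V ≤ U) (h' : W ≤ V) (s : M.Sec U) :
    M.res h' (M.res h s) = M.res (h'.trans h) s :=
  (congrArg (fun f => f.hom s) (M.presheaf.map_comp (homOfLE h).op (homOfLE h').op)).symm

/-- Constructor from elementwise data. -/
def ofRes (S : Opens X → Type u) [∀ U, AddCommMonoid (S U)] [∀ U, Module (X.Sec U) (S U)]
    (r : ∀ {U V : Opens X}, V ≤ U → S U →+ S V) (r_self : ∀ (U : Opens X) (s : S U), r le_rfl s = s)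
    (r_r : ∀ {U V W : Opens X} (h : V ≤ U) (h' : W ≤ V) (s : S U), r h' (r h s) = r (h'.trans h) s)
    (r_smul : ∀ {U V : Opens X} (h : V ≤ U) (a : X.Sec U) (s : S U),
      r h (a • s) = X.res h a • r h s) : OMod X where
  presheaf :=
    { obj := fun U => AddCommMonCat.of (S U.unop)
      map := fun i => AddCommMonCat.ofHom (r i.unop.le)
      map_id := fun U => by ext s; exact r_self _ s
      map_comp := fun i j => by ext s; exact (r_r _ _ s).symm }
  module U := (inferInstance : Module (X.Sec U) (S U))
  map_smul h a m := r_smul h a m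

/-- An isomorphism `M|_U ≅ N|_U` of presheaves of `𝒪_X|_U`-modules. -/
structure IsoOn (U : Opens X) (M N : OMod X) where
  app : ∀ V : Opens X, V ≤ U → M.Sec V ≃ₗ[X.Sec V] N.Sec V
  naturality : ∀ {V W : Opens X} (hV : V ≤ U) (h : W ≤ V) (m : M.Sec V),
    N.res h (app V hV m) = app W (h.trans hV) (M.res h m)

namespace IsoOn

variable {U : Opens X} {M N P : OMod X}

/-- The identity isomorphism. -/
def refl (U : Opens X) (M : OMod X) : IsoOn U M M := ⟨fun _ _ => LinearEquiv.refl _ _, fun _ _ _ => rfl⟩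

/-- The inverse isomorphism. -/
def symm (e : IsoOn U M N) : IsoOn U N M :=
  ⟨fun V hV => (e.app V hV).symm, fun {V W} hV h n => by
    rw [LinearEquiv.eq_symm_apply, ← e.naturality hV h, LinearEquiv.apply_symm_apply]⟩

/-- Composition of isomorphisms. -/
def trans (e : IsoOn U M N) (f : IsoOn U N P) : IsoOn U M P :=
  ⟨fun V hV => (e.app V hV).trans (f.app V hV), fun {V W} hV h m => by
    simp only [LinearEquiv.trans_apply, f.naturality hV h, e.naturality hV h]⟩

/-- Restriction of an isomorphism to a smaller open set. -/
def restrict (e : IsoOn U M N) {V : Opens X} (h : V ≤ U) : IsoOn V M N :=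
  ⟨fun W hW => e.app W (hW.trans h), fun hW h' m => e.naturality (hW.trans h) h' m⟩

end IsoOn

/-- `𝒪_X` as a module over itself. -/
def unit (X : SemiringedSpace.{u}) : OMod X :=
  ofRes X.Sec (fun h => (X.res h).toAddMonoidHom) (fun _ s => X.res_self _ s)
    (fun h h' s => X.res_res h h' s) (fun h a s => map_mul (X.res h) a s)

/-- Additive maps of commutative monoids from their properties. -/
abbrev mkHom {A B : Type u} [AddCommMonoid A] [AddCommMonoid B] (f : A → B) (h0 : f 0 = 0)
    (h : ∀ a b, f (a + b) = f a + f b) : A →+ B := ⟨⟨f, h0⟩, h⟩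

/-- The restriction `M(U) ⊗ N(U) → M(V) ⊗ N(V)`, `m ⊗ n ↦ m|_V ⊗ n|_V`. -/
def tensorRes (M N : OMod X) {U V : Opens X} (h : V ≤ U) :
    M.Sec U ⊗[X.Sec U] N.Sec U →+ M.Sec V ⊗[X.Sec V] N.Sec V :=
  TensorProduct.liftAddHom
    (mkHom (fun m => mkHom (fun n => M.res h m ⊗ₜ[X.Sec V] N.res h n)
        (by rw [map_zero, TensorProduct.tmul_zero])
        (fun n n' => by rw [map_add, TensorProduct.tmul_add]))
      (AddMonoidHom.ext fun n => by
        change M.res h 0 ⊗ₜ[X.Sec V] N.res h n = 0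
        rw [map_zero, TensorProduct.zero_tmul])
      (fun m m' => AddMonoidHom.ext fun n => by
        change M.res h (m + m') ⊗ₜ[X.Sec V] N.res h n =
          M.res h m ⊗ₜ[X.Sec V] N.res h n + M.res h m' ⊗ₜ[X.Sec V] N.res h n
        rw [map_add, TensorProduct.add_tmul]))
    (fun a m n => by
      change M.res h (a • m) ⊗ₜ[X.Sec V] N.res h n = M.res h m ⊗ₜ[X.Sec V] N.res h (a • n)
      rw [M.res_smul, N.res_smul, TensorProduct.smul_tmul])

lemma tensorRes_tmul (M N : OMod X) {U V : Opens X} (h : V ≤ U) (m : M.Sec U) (n : N.Sec U) :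
    tensorRes M N h (m ⊗ₜ[X.Sec U] n) = M.res h m ⊗ₜ[X.Sec V] N.res h n := rfl

lemma tensorRes_self (M N : OMod X) (U : Opens X) (s : M.Sec U ⊗[X.Sec U] N.Sec U) :
    tensorRes M N le_rfl s = s := by
  induction s using TensorProduct.induction_on with
  | zero => exact map_zero _
  | add a b ha hb => rw [map_add, ha, hb]
  | tmul m n => rw [tensorRes_tmul, M.res_self, N.res_self]

lemma tensorRes_tensorRes (M N : OMod X) {U V W : Opens X} (h : V ≤ U) (h' : W ≤ V)
    (s : M.Sec U ⊗[X.Sec U] N.Sec U) :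
    tensorRes M N h' (tensorRes M N h s) = tensorRes M N (h'.trans h) s := by
  induction s using TensorProduct.induction_on with
  | zero => rw [map_zero, map_zero, map_zero]
  | add a b ha hb => rw [map_add, map_add, map_add, ha, hb]
  | tmul m n => rw [tensorRes_tmul, tensorRes_tmul, tensorRes_tmul, M.res_res, N.res_res]

lemma tensorRes_smul (M N : OMod X) {U V : Opens X} (h : V ≤ U) (a : X.Sec U)
    (s : M.Sec U ⊗[X.Sec U] N.Sec U) :
    tensorRes M N h (a • s) = X.res h a • tensorRes M N h s := by
  induction s using TensorProduct.induction_on with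
  | zero => rw [smul_zero, map_zero, smul_zero]
  | add x y hx hy => rw [smul_add, map_add, map_add, smul_add, hx, hy]
  | tmul m n =>
    rw [TensorProduct.smul_tmul', tensorRes_tmul, tensorRes_tmul, M.res_smul,
      TensorProduct.smul_tmul']

/-- The presheaf tensor product `U ↦ M(U) ⊗_{𝒪_X(U)} N(U)`. -/
def tensorPresheaf (M N : OMod X) : OMod X :=
  ofRes (fun U => M.Sec U ⊗[X.Sec U] N.Sec U) (tensorRes M N) (tensorRes_self M N)
    (tensorRes_tensorRes M N) (tensorRes_smul M N)

lemma tensorRes_congr {U V : Opens X} {M M' N N' : OMod X} (h : V ≤ U)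
    (e : M.Sec U ≃ₗ[X.Sec U] M'.Sec U) (e' : M.Sec V ≃ₗ[X.Sec V] M'.Sec V)
    (f : N.Sec U ≃ₗ[X.Sec U] N'.Sec U) (f' : N.Sec V ≃ₗ[X.Sec V] N'.Sec V)
    (he : ∀ m, M'.res h (e m) = e' (M.res h m)) (hf : ∀ n, N'.res h (f n) = f' (N.res h n))
    (s : M.Sec U ⊗[X.Sec U] N.Sec U) :
    tensorRes M' N' h (TensorProduct.congr e f s) =
      TensorProduct.congr e' f' (tensorRes M N h s) := by
  induction s using TensorProduct.induction_on with
  | zero => simp only [map_zero]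
  | add a b ha hb => rw [map_add, map_add, map_add, map_add, ha, hb]
  | tmul m n =>
    rw [TensorProduct.congr_tmul, tensorRes_tmul, tensorRes_tmul, TensorProduct.congr_tmul, he, hf]

/-- The presheaf tensor product is functorial in isomorphisms. -/
def IsoOn.tensorPresheaf {U : Opens X} {M M' N N' : OMod X} (e : IsoOn U M M')
    (f : IsoOn U N N') : IsoOn U (tensorPresheaf M N) (tensorPresheaf M' N') :=
  ⟨fun V hV => (TensorProduct.congr (e.app V hV) (f.app V hV) :
      M.Sec V ⊗[X.Sec V] N.Sec V ≃ₗ[X.Sec V] M'.Sec V ⊗[X.Sec V] N'.Sec V),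
    fun hV h s => tensorRes_congr h _ _ _ _ (e.naturality hV h) (f.naturality hV h) s⟩

/-- Multiplication `𝒪_X(V) ⊗ 𝒪_X(V) ≅ 𝒪_X(V)`. -/
def tensorUnitApp (X : SemiringedSpace.{u}) (V : Opens X) :
    (unit X).Sec V ⊗[X.Sec V] (unit X).Sec V ≃ₗ[X.Sec V] X.Sec V :=
  TensorProduct.lid (X.Sec V) (X.Sec V)

lemma tensorUnitApp_res {V W : Opens X} (h : W ≤ V)
    (s : (unit X).Sec V ⊗[X.Sec V] (unit X).Sec V) :
    X.res h (tensorUnitApp X V s) = tensorUnitApp X W (tensorRes (unit X) (unit X) h s) := by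
  induction s using TensorProduct.induction_on with
  | zero => simp only [map_zero]
  | add a b ha hb => rw [map_add, map_add, map_add, map_add, ha, hb]
  | tmul m n => exact map_mul (X.res h) (show X.Sec V from m) (show X.Sec V from n)

/-- `𝒪_X ⊗ 𝒪_X ≅ 𝒪_X` for the presheaf tensor product. -/
def tensorUnit (U : Opens X) : IsoOn U (tensorPresheaf (unit X) (unit X)) (unit X) :=
  ⟨fun V _ => tensorUnitApp X V, fun _ h s => tensorUnitApp_res h s⟩

/-! ### Sheafification of presheaves of modules -/

instance directedSystem (M : OMod X) (x : X) :
    DirectedSystem (fun U : NhdIndex x => M.Sec U.opens)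
      (fun _ _ h => M.res (NhdIndex.opens_le h)) where
  map_self _ s := M.res_self _ s
  map_map _ _ _ _ _ s := M.res_res _ _ s

/-- The stalk `M_x`. -/
abbrev Stalk (M : OMod X) (x : X) : Type u :=
  DirectLimit (fun U : NhdIndex x => M.Sec U.opens) (fun _ _ h => M.res (NhdIndex.opens_le h))

/-- The germ at `x` of a section on an open neighbourhood of `x`. -/
def germ (M : OMod X) {x : X} (U : Opens X) (hx : x ∈ U) : M.Sec U →+ M.Stalk x :=
  mkHom (fun s => ⟦⟨NhdIndex.mk U hx, s⟩⟧)
    (DirectLimit.zero_def (NhdIndex.mk U hx)).symm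
    (fun s t => (DirectLimit.add_def (G := fun U : NhdIndex x => M.Sec U.opens)
      (f := fun _ _ h => M.res (NhdIndex.opens_le h)) (NhdIndex.mk U hx) s t).symm)

lemma germ_res (M : OMod X) {x : X} {U V : Opens X} (h : V ≤ U) (hx : x ∈ V)
    (s : M.Sec U) : M.germ V hx (M.res h s) = M.germ U (h hx) s :=
  (DirectLimit.eq_of_le (F := fun U : NhdIndex x => M.Sec U.opens)
    (f := fun _ _ h => M.res (NhdIndex.opens_le h)) ⟨NhdIndex.mk U (h hx), s⟩
    (NhdIndex.mk V hx) h).symm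

lemma exists_germ_eq (M : OMod X) {x : X} (z : M.Stalk x) :
    ∃ (U : Opens X) (hx : x ∈ U) (s : M.Sec U), M.germ U hx s = z := by
  obtain ⟨U, s, rfl⟩ := DirectLimit.exists_eq_mk _ z
  exact ⟨U.opens, (OrderDual.ofDual U).2, s, rfl⟩

lemma germ_eq_iff (M : OMod X) {x : X} {U : Opens X} (hx : x ∈ U) (s t : M.Sec U) :
    M.germ U hx s = M.germ U hx t ↔
      ∃ (V : Opens X) (h : V ≤ U), x ∈ V ∧ M.res h s = M.res h t := by
  constructor
  · intro h
    obtain ⟨V, h1, h2, h3⟩ := Quotient.exact h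
    exact ⟨V.opens, h1, (OrderDual.ofDual V).2, h3⟩
  · rintro ⟨V, h, hxV, e⟩
    rw [← M.germ_res h hxV, ← M.germ_res h hxV, e]

/-- The action of `𝒪_{X,x}` on `M_x`. -/
instance stalkSMul (M : OMod X) (x : X) : SMul (X.Stalk x) (M.Stalk x) :=
  ⟨DirectLimit.map₂ (fun _ _ h => X.res (NhdIndex.opens_le h))
    (fun _ _ h => M.res (NhdIndex.opens_le h)) (fun _ _ h => M.res (NhdIndex.opens_le h))
    (fun _ a m => a • m) (fun _ _ h a m => M.res_smul (NhdIndex.opens_le h) a m)⟩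

lemma germ_smul (M : OMod X) {x : X} (U : Opens X) (hx : x ∈ U) (a : X.Sec U) (m : M.Sec U) :
    M.germ U hx (a • m) = X.germ U hx a • M.germ U hx m :=
  (DirectLimit.map₂_def (fun _ _ h => X.res (NhdIndex.opens_le h))
    (fun _ _ h => M.res (NhdIndex.opens_le h)) (fun _ _ h => M.res (NhdIndex.opens_le h))
    (fun (i : NhdIndex x) (a : X.Sec i.opens) (m : M.Sec i.opens) => a • m)
    (fun _ _ h a m => M.res_smul (NhdIndex.opens_le h) a m) (NhdIndex.mk U hx) a m).symm

lemma exists_germ_eq₃ (M : OMod X) {x : X} (a b : X.Stalk x) (z w : M.Stalk x) :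
    ∃ (U : Opens X) (hx : x ∈ U) (s t : X.Sec U) (m n : M.Sec U),
      X.germ U hx s = a ∧ X.germ U hx t = b ∧ M.germ U hx m = z ∧ M.germ U hx n = w := by
  obtain ⟨U₁, h₁, s, rfl⟩ := X.exists_germ_eq a
  obtain ⟨U₂, h₂, t, rfl⟩ := X.exists_germ_eq b
  obtain ⟨U₃, h₃, m, rfl⟩ := M.exists_germ_eq z
  obtain ⟨U₄, h₄, n, rfl⟩ := M.exists_germ_eq w
  have h : x ∈ (U₁ ⊓ U₂) ⊓ (U₃ ⊓ U₄) := ⟨⟨h₁, h₂⟩, h₃, h₄⟩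
  exact ⟨(U₁ ⊓ U₂) ⊓ (U₃ ⊓ U₄), h, X.res (inf_le_left.trans inf_le_left) s,
    X.res (inf_le_left.trans inf_le_right) t, M.res (inf_le_right.trans inf_le_left) m,
    M.res (inf_le_right.trans inf_le_right) n, X.germ_res _ h s, X.germ_res _ h t,
    M.germ_res _ h m, M.germ_res _ h n⟩

instance stalkModule (M : OMod X) (x : X) : Module (X.Stalk x) (M.Stalk x) where
  one_smul z := by
    obtain ⟨U, hx, _, _, m, _, _, _, rfl, _⟩ := exists_germ_eq₃ M 0 0 z 0
    rw [← map_one (X.germ U hx), ← germ_smul, one_smul]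
  mul_smul a b z := by
    obtain ⟨U, hx, s, t, m, _, rfl, rfl, rfl, _⟩ := exists_germ_eq₃ M a b z 0
    rw [← map_mul, ← germ_smul, ← germ_smul, ← germ_smul, mul_smul]
  smul_zero a := by
    obtain ⟨U, hx, s, _, _, _, rfl, _, _, _⟩ := exists_germ_eq₃ M a 0 0 0
    rw [← map_zero (M.germ U hx), ← germ_smul, smul_zero]
  smul_add a z w := by
    obtain ⟨U, hx, s, _, m, n, rfl, _, rfl, rfl⟩ := exists_germ_eq₃ M a 0 z w
    rw [← map_add, ← germ_smul, ← germ_smul, ← germ_smul, ← map_add, smul_add]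
  add_smul a b z := by
    obtain ⟨U, hx, s, t, m, _, rfl, rfl, rfl, _⟩ := exists_germ_eq₃ M a b z 0
    rw [← map_add, ← germ_smul, ← germ_smul, ← germ_smul, ← map_add, add_smul]
  zero_smul z := by
    obtain ⟨U, hx, _, _, m, _, _, _, rfl, _⟩ := exists_germ_eq₃ M 0 0 z 0
    rw [← map_zero (X.germ U hx), ← germ_smul, zero_smul, map_zero]

/-- Families of elements of the stalks given by a single section. -/
def isGerm (M : OMod X) : TopCat.PrelocalPredicate (fun x : X => M.Stalk x) where
  pred {U} f := ∃ m : M.Sec U, ∀ x : U, f x = M.germ U x.2 m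
  res := by
    rintro V U i f ⟨m, h⟩
    exact ⟨M.res i.le m, fun x => (h ⟨x.1, i.le x.2⟩).trans (M.germ_res i.le x.2 m).symm⟩

/-- The sections on `U` of the sheafification of `M`: families of elements of the stalks `M_x`,
`x ∈ U`, that are locally given by sections of `M`. -/
def sheafifySec (M : OMod X) (U : Opens X) : AddSubmonoid (∀ x : U, M.Stalk x.1) where
  carrier := {f | (isGerm M).sheafify.pred f}
  zero_mem' := TopCat.PrelocalPredicate.sheafifyOf ⟨0, fun x => (map_zero (M.germ U x.2)).symm⟩
  add_mem' := by
    intro f g hf hg p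
    obtain ⟨V, hV, i, m, h⟩ := hf p
    obtain ⟨W, hW, j, n, k⟩ := hg p
    refine ⟨V ⊓ W, ⟨hV, hW⟩, Opens.infLELeft _ _ ≫ i,
      M.res inf_le_left m + M.res inf_le_right n, fun q => ?_⟩
    rw [map_add, M.germ_res, M.germ_res]
    exact congrArg₂ (· + ·) (h ⟨q.1, q.2.1⟩) (k ⟨q.1, q.2.2⟩)

lemma sheafifySec_smul_mem (M : OMod X) {U : Opens X} (a : X.Sec U) (f : sheafifySec M U) :
    (fun x : U => X.germ U x.2 a • f.1 x) ∈ sheafifySec M U := by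
  intro p
  obtain ⟨V, hV, i, m, h⟩ := f.2 p
  refine ⟨V, hV, i, X.res i.le a • m, fun q => ?_⟩
  rw [germ_smul, X.germ_res]
  exact congrArg (X.germ U (i.le q.2) a • ·) (h q)

instance sheafifySecModule (M : OMod X) (U : Opens X) : Module (X.Sec U) (sheafifySec M U) where
  smul a f := ⟨fun x => X.germ U x.2 a • f.1 x, sheafifySec_smul_mem M a f⟩
  one_smul f := Subtype.ext (funext fun x =>
    (congrArg (· • f.1 x) (map_one (X.germ U x.2))).trans (one_smul _ _))
  mul_smul a b f := Subtype.ext (funext fun x =>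
    (congrArg (· • f.1 x) (map_mul (X.germ U x.2) a b)).trans (mul_smul _ _ _))
  smul_zero a := Subtype.ext (funext fun x => smul_zero (X.germ U x.2 a))
  smul_add a f g := Subtype.ext (funext fun x => smul_add (X.germ U x.2 a) (f.1 x) (g.1 x))
  add_smul a b f := Subtype.ext (funext fun x =>
    (congrArg (· • f.1 x) (map_add (X.germ U x.2) a b)).trans (add_smul _ _ _))
  zero_smul f := Subtype.ext (funext fun x =>
    (congrArg (· • f.1 x) (map_zero (X.germ U x.2))).trans (zero_smul _ _))

/-- Restriction of families of elements of stalks. -/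
def sheafifyRes (M : OMod X) {U V : Opens X} (h : V ≤ U) : sheafifySec M U →+ sheafifySec M V :=
  mkHom (fun f => ⟨fun x => f.1 ⟨x.1, h x.2⟩, (isGerm M).sheafify.res (homOfLE h) f.1 f.2⟩)
    rfl (fun _ _ => rfl)

/-- The sheafification of a presheaf of `𝒪_X`-modules. -/
def sheafify (M : OMod X) : OMod X :=
  ofRes (fun U => sheafifySec M U) (sheafifyRes M) (fun _ _ => rfl) (fun _ _ _ => rfl)
    (fun h a f => Subtype.ext (funext fun x =>
      congrArg (· • f.1 ⟨x.1, h x.2⟩) (X.germ_res h x.2 a).symm))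

/-- A sheaf of `𝒪_X`-modules. -/
def IsSheaf (M : OMod X) : Prop := M.presheaf.IsSheaf

lemma sheafify_isSheaf (M : OMod X) : (sheafify M).IsSheaf :=
  (TopCat.Presheaf.isSheaf_iff_isSheaf_comp (forget AddCommMonCat.{u}) _).2
    (TopCat.subpresheafToTypes.isSheaf (isGerm M).sheafify)

/-- The canonical map `M(U) → M⁺(U)`. -/
def toSheafify (M : OMod X) (U : Opens X) : M.Sec U →ₗ[X.Sec U] sheafifySec M U where
  toFun m := ⟨fun x => M.germ U x.2 m,
    TopCat.PrelocalPredicate.sheafifyOf (P := isGerm M) ⟨m, fun _ => rfl⟩⟩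
  map_add' m n := Subtype.ext (funext fun x => map_add (M.germ U x.2) m n)
  map_smul' a m := Subtype.ext (funext fun x => germ_smul M U x.2 a m)

lemma toSheafify_unit_bijective (U : Opens X) :
    Function.Bijective (toSheafify (unit X) U) := by
  have key : ∀ (V : Opens X) (s t : X.Sec V),
      (∀ x (hx : x ∈ V), (unit X).germ V hx s = (unit X).germ V hx t) → s = t := by
    intro V s t h
    have h' : ∀ x : V, ∃ (W : Opens X) (hW : W ≤ V), x.1 ∈ W ∧ X.res hW s = X.res hW t :=
      fun x => ((unit X).germ_eq_iff x.2 s t).1 (h x.1 x.2)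
    choose W hW hx e using h'
    exact TopCat.Sheaf.eq_of_locally_eq' X.sheaf W V (fun x => homOfLE (hW x))
      (fun x hx' => Opens.mem_iSup.2 ⟨⟨x, hx'⟩, hx ⟨x, hx'⟩⟩) s t e
  constructor
  · intro s t h
    exact key U s t fun x hx => congrFun (congrArg Subtype.val h) ⟨x, hx⟩
  · intro f
    choose V hV i m h using f.2
    obtain ⟨s, hs, -⟩ := TopCat.Sheaf.existsUnique_gluing' X.sheaf V U i
      (fun x hx' => Opens.mem_iSup.2 ⟨⟨x, hx'⟩, hV ⟨x, hx'⟩⟩) m (by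
        intro p q
        refine key _ _ _ fun x hx => ?_
        exact ((unit X).germ_res inf_le_left hx (m p)).trans
          ((h p ⟨x, hx.1⟩).symm.trans
            ((h q ⟨x, hx.2⟩).trans ((unit X).germ_res inf_le_right hx (m q)).symm)))
    refine ⟨s, Subtype.ext (funext fun x => ?_)⟩
    have := h x ⟨x.1, hV x⟩
    refine Eq.trans ?_ this.symm
    exact ((unit X).germ_res (i x).le (hV x) s).symm.trans
      (congrArg ((unit X).germ (V x) (hV x)) (hs x))

/-- The sheaf `𝒪_X` is its own sheafification. -/
def unitSheafify (U : Opens X) : IsoOn U (unit X) (sheafify (unit X)) :=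
  ⟨fun V _ => LinearEquiv.ofBijective (toSheafify (unit X) V) (toSheafify_unit_bijective V),
    fun _ h m => Subtype.ext (funext fun x => ((unit X).germ_res h x.2 m).symm)⟩

/-- The map on stalks induced by an isomorphism on a neighbourhood. -/
def IsoOn.stalkMap {U : Opens X} {M N : OMod X} (e : IsoOn U M N) {x : X} (hx : x ∈ U) :
    M.Stalk x → N.Stalk x :=
  DirectLimit.lift (fun _ _ h => M.res (NhdIndex.opens_le h))
    (fun (W : NhdIndex x) m => N.germ (W.opens ⊓ U) ⟨(OrderDual.ofDual W).2, hx⟩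
      (e.app (W.opens ⊓ U) inf_le_right (M.res inf_le_left m)))
    (fun W W' h m => by
      have hW := NhdIndex.opens_le h
      rw [← N.germ_res (inf_le_inf_right U hW) ⟨(OrderDual.ofDual W').2, hx⟩, e.naturality,
        M.res_res, M.res_res])

lemma IsoOn.stalkMap_germ {U : Opens X} {M N : OMod X} (e : IsoOn U M N) {x : X} {W : Opens X}
    (hW : W ≤ U) (hx : x ∈ W) (m : M.Sec W) :
    e.stalkMap (hW hx) (M.germ W hx m) = N.germ W hx (e.app W hW m) := by
  change N.germ (W ⊓ U) ⟨hx, hW hx⟩ (e.app (W ⊓ U) inf_le_right (M.res inf_le_left m)) = _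
  rw [← e.naturality hW]
  exact N.germ_res inf_le_left (show x ∈ W ⊓ U from ⟨hx, hW hx⟩) _

lemma exists_germ_eq_le (M : OMod X) {x : X} (z : M.Stalk x) {U : Opens X} (hx : x ∈ U) :
    ∃ (W : Opens X) (_ : W ≤ U) (hxW : x ∈ W) (m : M.Sec W), M.germ W hxW m = z := by
  obtain ⟨W, hW, m, rfl⟩ := M.exists_germ_eq z
  exact ⟨W ⊓ U, inf_le_right, ⟨hW, hx⟩, M.res inf_le_left m, M.germ_res inf_le_left ⟨hW, hx⟩ m⟩

lemma IsoOn.stalkMap_symm {U : Opens X} {M N : OMod X} (e : IsoOn U M N) {x : X} (hx : x ∈ U)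
    (z : M.Stalk x) : e.symm.stalkMap hx (e.stalkMap hx z) = z := by
  obtain ⟨W, hW, hxW, m, rfl⟩ := M.exists_germ_eq_le z hx
  rw [e.stalkMap_germ hW hxW, e.symm.stalkMap_germ hW hxW]
  exact congrArg _ ((e.app W hW).symm_apply_apply m)

lemma IsoOn.stalkMap_add {U : Opens X} {M N : OMod X} (e : IsoOn U M N) {x : X} (hx : x ∈ U)
    (z w : M.Stalk x) : e.stalkMap hx (z + w) = e.stalkMap hx z + e.stalkMap hx w := by
  obtain ⟨V, hV, hxV, m, rfl⟩ := M.exists_germ_eq_le z hx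
  obtain ⟨W, hW, hxW, n, rfl⟩ := M.exists_germ_eq_le w hxV
  rw [← M.germ_res hW hxW, ← map_add, e.stalkMap_germ (hW.trans hV) hxW,
    e.stalkMap_germ (hW.trans hV) hxW, e.stalkMap_germ (hW.trans hV) hxW, map_add, map_add]

lemma IsoOn.stalkMap_smul {U : Opens X} {M N : OMod X} (e : IsoOn U M N) {x : X} (hx : x ∈ U)
    (a : X.Stalk x) (z : M.Stalk x) : e.stalkMap hx (a • z) = a • e.stalkMap hx z := by
  obtain ⟨V, hV, s, rfl⟩ := X.exists_germ_eq a
  obtain ⟨W, hW, hxW, m, rfl⟩ := M.exists_germ_eq_le z (U := V ⊓ U) ⟨hV, hx⟩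
  have hWU := hW.trans inf_le_right
  rw [← X.germ_res (hW.trans inf_le_left) hxW, ← germ_smul, e.stalkMap_germ hWU hxW,
    e.stalkMap_germ hWU hxW,
    LinearEquiv.map_smul, germ_smul]

lemma IsoOn.stalkMap_mem {U V : Opens X} {M N : OMod X} (e : IsoOn U M N) (hV : V ≤ U)
    (f : sheafifySec M V) : (fun x : V => e.stalkMap (hV x.2) (f.1 x)) ∈ sheafifySec N V := by
  intro p
  obtain ⟨W, hW, i, m, h⟩ := f.2 p
  refine ⟨W, hW, i, e.app W (i.le.trans hV) m, fun q => ?_⟩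
  rw [← e.stalkMap_germ (i.le.trans hV) q.2, ← h q]

/-- Sheafification is functorial in isomorphisms. -/
def IsoOn.sheafify {U : Opens X} {M N : OMod X} (e : IsoOn U M N) :
    IsoOn U (sheafify M) (sheafify N) :=
  ⟨fun V hV =>
    ({ toFun := fun f => ⟨_, e.stalkMap_mem hV f⟩
       map_add' := fun f g => Subtype.ext (funext fun x => e.stalkMap_add (hV x.2) (f.1 x) (g.1 x))
       map_smul' := fun _ f => Subtype.ext (funext fun x => e.stalkMap_smul (hV x.2) _ (f.1 x))
       invFun := fun f => ⟨_, e.symm.stalkMap_mem hV f⟩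
       left_inv := fun f => Subtype.ext (funext fun x => e.stalkMap_symm (hV x.2) (f.1 x))
       right_inv := fun f => Subtype.ext (funext fun x => e.symm.stalkMap_symm (hV x.2) (f.1 x)) } :
      sheafifySec M V ≃ₗ[X.Sec V] sheafifySec N V),
    fun _ _ _ => rfl⟩

/-! ### Invertible sheaves and the Picard group -/

/-- The tensor product `M ⊗_{𝒪_X} N`: the sheafification of `U ↦ M(U) ⊗_{𝒪_X(U)} N(U)`. -/
def tensor (M N : OMod X) : OMod X := sheafify (tensorPresheaf M N)

/-- An invertible sheaf: a sheaf of `𝒪_X`-modules locally isomorphic to `𝒪_X`. -/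
structure IsInvertible (L : OMod X) : Prop where
  isSheaf : L.IsSheaf
  locally_unit : ∀ x : X, ∃ U : Opens X, x ∈ U ∧ Nonempty (IsoOn U L (unit X))

lemma IsInvertible.tensor {L L' : OMod X} (h : L.IsInvertible) (h' : L'.IsInvertible) :
    (tensor L L').IsInvertible where
  isSheaf := sheafify_isSheaf _
  locally_unit x := by
    obtain ⟨U, hU, ⟨e⟩⟩ := h.locally_unit x
    obtain ⟨V, hV, ⟨f⟩⟩ := h'.locally_unit x
    exact ⟨U ⊓ V, ⟨hU, hV⟩, ⟨((((e.restrict inf_le_left).tensorPresheaf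
      (f.restrict inf_le_right)).trans (tensorUnit _)).sheafify).trans (unitSheafify _).symm⟩⟩

/-- Isomorphism of `𝒪_X`-modules on all of `X`. -/
abbrev Iso (M N : OMod X) : Type u := IsoOn ⊤ M N

/-- Invertible sheaves up to isomorphism. -/
instance picSetoid (X : SemiringedSpace.{u}) : Setoid {L : OMod X // L.IsInvertible} where
  r L L' := Nonempty (Iso L.1 L'.1)
  iseqv := ⟨fun _ => ⟨IsoOn.refl _ _⟩, fun ⟨e⟩ => ⟨e.symm⟩, fun ⟨e⟩ ⟨f⟩ => ⟨e.trans f⟩⟩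

end OMod

/-- `Pic X`: isomorphism classes of invertible sheaves on `X`. -/
def Pic (X : SemiringedSpace.{u}) : Type (u + 1) := Quotient (OMod.picSetoid X)

namespace Pic

variable {X : SemiringedSpace.{u}}

/-- The class `[L]` of an invertible sheaf. -/
def mk (L : OMod X) (h : L.IsInvertible) : Pic X := Quotient.mk _ ⟨L, h⟩

/-- The operation of `Pic X`: `[L] * [L'] = [L ⊗ L']`. -/
instance instMul : Mul (Pic X) :=
  ⟨Quotient.map₂ (fun L L' => ⟨OMod.tensor L.1 L'.1, L.2.tensor L'.2⟩)
    (fun _ _ ⟨e⟩ _ _ ⟨f⟩ => ⟨(e.tensorPresheaf f).sheafify⟩)⟩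

end Pic

/-! ### Cancellative semiring schemes are irreducible and sober -/

namespace SemiringScheme

lemma nontrivial_sec (X : SemiringScheme.{u}) {U : Opens X.toSheafedSpace}
    (hU : (U : Set X.toSheafedSpace).Nonempty) :
    Nontrivial (SemiringedSpace.Sec X.toSheafedSpace U) := by
  obtain ⟨x, hx⟩ := hU
  have := X.isLocalRing_stalk x
  exact (SemiringedSpace.germ X.toSheafedSpace U hx).domain_nontrivial

/-- Gluing of sections on disjoint open sets. -/
lemma exists_glue (X : SemiringedSpace.{u}) (U : Bool → Opens X) (hd : U true ⊓ U false = ⊥)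
    (s : ∀ i, X.Sec (U i)) :
    ∃ r : X.Sec (iSup U), ∀ i, X.res (le_iSup U i) r = s i := by
  have hbot : ∀ (W : Opens X), W ≤ ⊥ → ∀ a b : X.Sec W, a = b := fun W hW a b =>
    TopCat.Sheaf.eq_of_locally_eq' X.sheaf (fun i : PEmpty.{u + 1} => i.elim) W
      (fun i => i.elim) (hW.trans bot_le) a b (fun i => i.elim)
  obtain ⟨r, hr, -⟩ := TopCat.Sheaf.existsUnique_gluing' X.sheaf U (iSup U)
    (fun i => homOfLE (le_iSup U i)) le_rfl s (by
      intro i j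
      cases i <;> cases j
      · rfl
      · exact hbot _ (by rw [inf_comm, hd]) _ _
      · exact hbot _ hd.le _ _
      · rfl)
  exact ⟨r, hr⟩

instance irreducibleSpace (X : SemiringScheme.{u}) [X.IsCancellative]
    [Nonempty X.toSheafedSpace] : IrreducibleSpace X.toSheafedSpace where
  toNonempty := inferInstance
  isPreirreducible_univ := by
    rintro u v hu hv ⟨x, -, hx⟩ ⟨y, -, hy⟩
    by_contra hne
    let U : Bool → Opens X.toSheafedSpace := fun b => bif b then ⟨u, hu⟩ else ⟨v, hv⟩
    have hd : U true ⊓ U false = ⊥ := by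
      ext z
      exact ⟨fun hz => (hne ⟨z, trivial, hz⟩).elim, fun hz => hz.elim⟩
    have ht := X.nontrivial_sec (U := U true) ⟨x, hx⟩
    have hf := X.nontrivial_sec (U := U false) ⟨y, hy⟩
    obtain ⟨e, he⟩ := exists_glue X.toSheafedSpace U hd (fun b => bif b then 1 else 0)
    obtain ⟨a, ha⟩ := exists_glue X.toSheafedSpace U hd (fun b => bif b then 0 else 1)
    obtain ⟨z, hz⟩ := exists_glue X.toSheafedSpace U hd (fun _ => 0)
    have hsep : ∀ s t : SemiringedSpace.Sec X.toSheafedSpace (iSup U),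
        (∀ i, SemiringedSpace.res X.toSheafedSpace (le_iSup U i) s =
          SemiringedSpace.res X.toSheafedSpace (le_iSup U i) t) → s = t := fun s t h =>
      TopCat.Sheaf.eq_of_locally_eq' X.sheaf U (iSup U) (fun i => homOfLE (le_iSup U i)) le_rfl
        s t h
    have he0 : e ≠ 0 := by
      rintro rfl
      have := he true
      rw [map_zero] at this
      exact zero_ne_one this
    have hae : a * e = 0 * e := hsep _ _ fun i => by
      rw [zero_mul, map_mul, map_zero, ha, he]
      cases i <;> simp
    have ha0 := IsCancellative.cancel (X := X) (iSup U) e he0 a 0 hae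
    subst ha0
    have := ha false
    rw [map_zero] at this
    exact zero_ne_one this

instance quasiSober (X : SemiringScheme.{u}) : QuasiSober X.toSheafedSpace := by
  choose U hU A e using X.locally_affine
  have hcov : IsOpenCover U :=
    IsOpenCover.mk (top_le_iff.1 fun x _ => Opens.mem_iSup.2 ⟨x, hU x⟩)
  have : ∀ x, QuasiSober (U x) := fun x => by
    obtain ⟨i⟩ := e x
    have hA : QuasiSober (PrimeSpectrum (A x)) := inferInstance
    exact @Topology.IsOpenEmbedding.quasiSober _ (PrimeSpectrum (A x)) _ _ _
      (TopCat.homeoOfIso ((AlgebraicGeometry.SheafedSpace.forget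
        CommSemiRingCat.{u}).mapIso i)).isOpenEmbedding hA
  exact hcov.quasiSober

end SemiringScheme

/-! ### Cartier divisors -/

namespace SemiringedSpace

variable (X : SemiringedSpace.{u}) [IrreducibleSpace X] [QuasiSober X]

/-- The function field `K = 𝒪_{X,η}`, where `η` is the generic point of `X`. -/
def FunctionField : Type u := X.Stalk (genericPoint X)

instance functionFieldCommSemiring : CommSemiring X.FunctionField :=
  inferInstanceAs (CommSemiring (X.Stalk (genericPoint X)))

variable {X} in
lemma genericPoint_mem {U : Opens X} (x : U) : genericPoint X ∈ U :=
  (genericPoint_specializes x.1).mem_open U.2 x.2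

/-- The sections on `U` of the constant sheaf `𝒦` associated to `K`: locally constant functions
`U → K`. -/
def RatSec (U : Opens X) : Type u := LocallyConstant U X.FunctionField

instance ratSecCommSemiring (U : Opens X) : CommSemiring (X.RatSec U) :=
  inferInstanceAs (CommSemiring (LocallyConstant U X.FunctionField))

/-- Restriction `𝒦(U) → 𝒦(V)`. -/
def ratRes {U V : Opens X} (h : V ≤ U) : X.RatSec U →+* X.RatSec V where
  toFun s := LocallyConstant.comap ⟨Set.inclusion h, continuous_inclusion h⟩ s
  map_zero' := rfl
  map_one' := rfl
  map_add' _ _ := rfl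
  map_mul' _ _ := rfl

/-- The constant functions `K → 𝒦(U)`. -/
def ratConst (U : Opens X) : X.FunctionField →+* X.RatSec U :=
  (LocallyConstant.constRingHom : X.FunctionField →+* LocallyConstant U X.FunctionField)

/-- The canonical homomorphism `𝒪_X(U) → 𝒦(U)`, sending a section to its germ at `η`. -/
def toRat (U : Opens X) : X.Sec U →+* X.RatSec U where
  toFun s := ⟨fun x => X.germ U (genericPoint_mem x) s, IsLocallyConstant.of_constant _
    fun _ _ => rfl⟩
  map_zero' := LocallyConstant.ext fun x => map_zero (X.germ U (genericPoint_mem x))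
  map_one' := LocallyConstant.ext fun x => map_one (X.germ U (genericPoint_mem x))
  map_add' s t := LocallyConstant.ext fun x => map_add (X.germ U (genericPoint_mem x)) s t
  map_mul' s t := LocallyConstant.ext fun x => map_mul (X.germ U (genericPoint_mem x)) s t

lemma ratRes_toRat {U V : Opens X} (h : V ≤ U) (s : X.Sec U) :
    X.ratRes h (X.toRat U s) = X.toRat V (X.res h s) :=
  LocallyConstant.ext fun x => (X.germ_res h (genericPoint_mem x) s).symm

/-- The image of `𝒪_X^×(U)` in `𝒦^×(U)`. -/
def unitsRange (U : Opens X) : Subgroup (X.RatSec U)ˣ :=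
  (Units.map (X.toRat U).toMonoidHom).range

lemma unitsRange_le {U V : Opens X} (h : V ≤ U) :
    X.unitsRange U ≤ (X.unitsRange V).comap (Units.map (X.ratRes h).toMonoidHom) := by
  rintro _ ⟨a, rfl⟩
  exact ⟨Units.map (X.res h).toMonoidHom a, Units.ext (X.ratRes_toRat h a).symm⟩

/-- Restriction `𝒦^×(U) / 𝒪_X^×(U) → 𝒦^×(V) / 𝒪_X^×(V)`. -/
def unitsQuotRes {U V : Opens X} (h : V ≤ U) :
    (X.RatSec U)ˣ ⧸ X.unitsRange U →* (X.RatSec V)ˣ ⧸ X.unitsRange V :=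
  QuotientGroup.map _ _ (Units.map (X.ratRes h).toMonoidHom) (X.unitsRange_le h)

lemma unitsQuotRes_self (U : Opens X) (q : (X.RatSec U)ˣ ⧸ X.unitsRange U) :
    X.unitsQuotRes le_rfl q = q :=
  QuotientGroup.induction_on q fun _ => rfl

lemma unitsQuotRes_res {U V W : Opens X} (h : V ≤ U) (h' : W ≤ V)
    (q : (X.RatSec U)ˣ ⧸ X.unitsRange U) :
    X.unitsQuotRes (h'.trans h) q = X.unitsQuotRes h' (X.unitsQuotRes h q) :=
  QuotientGroup.induction_on q fun _ => rfl

/-- The presheaf of abelian groups `U ↦ 𝒦^×(U) / 𝒪_X^×(U)`, written additively. -/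
def unitsQuotPresheaf : TopCat.Presheaf AddCommGrpCat.{u} X where
  obj U := AddCommGrpCat.of (Additive ((X.RatSec U.unop)ˣ ⧸ X.unitsRange U.unop))
  map i := AddCommGrpCat.ofHom (X.unitsQuotRes i.unop.le).toAdditive
  map_id U := AddCommGrpCat.hom_ext (AddMonoidHom.ext fun q => X.unitsQuotRes_self U.unop q)
  map_comp i j := AddCommGrpCat.hom_ext (AddMonoidHom.ext fun q =>
    X.unitsQuotRes_res i.unop.le j.unop.le q)

/-- The quotient sheaf `𝒦^× / 𝒪_X^×`: the sheafification of `U ↦ 𝒦^×(U) / 𝒪_X^×(U)`. -/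
def unitsQuotSheaf : TopCat.Sheaf AddCommGrpCat.{u} X :=
  (presheafToSheaf (Opens.grothendieckTopology X) AddCommGrpCat.{u}).obj X.unitsQuotPresheaf

/-- The sections of `𝒦^× / 𝒪_X^×` on `U`. -/
abbrev DivSec (U : Opens X) : Type u := X.unitsQuotSheaf.obj.obj (op U)

/-- Restriction of sections of `𝒦^× / 𝒪_X^×`. -/
def divRes {U V : Opens X} (h : V ≤ U) : X.DivSec U →+ X.DivSec V :=
  (X.unitsQuotSheaf.obj.map (homOfLE h).op).hom

/-- The canonical homomorphism `𝒦^×(U) → (𝒦^× / 𝒪_X^×)(U)`. -/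
def divOf (U : Opens X) : Additive (X.RatSec U)ˣ →+ X.DivSec U :=
  ((toSheafify (Opens.grothendieckTopology X) X.unitsQuotPresheaf).app (op U)).hom.comp
    (QuotientGroup.mk' (X.unitsRange U)).toAdditive

/-- `Cart X`: Cartier divisors, i.e. global sections of `𝒦^× / 𝒪_X^×`. -/
abbrev CartierDivisor : Type u := X.DivSec ⊤

/-- The principal Cartier divisors: those represented by a single element of `K^×`. -/
def principalDivisors : AddSubgroup X.CartierDivisor :=
  ((X.divOf ⊤).comp (Units.map (X.ratConst ⊤).toMonoidHom).toAdditive).range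

/-- `CaCl X`: Cartier divisors modulo principal Cartier divisors (an additive group). -/
abbrev CaCl : Type u := X.CartierDivisor ⧸ X.principalDivisors

/-- `𝒦(U)` is an `𝒪_X(U)`-module through `𝒪_X(U) → 𝒦(U)`. -/
instance ratModule (U : Opens X) : Module (X.Sec U) (X.RatSec U) :=
  Module.compHom _ (X.toRat U)

lemma ratRes_smul {U V : Opens X} (h : V ≤ U) (a : X.Sec U) (s : X.RatSec U) :
    X.ratRes h (a • s) = X.res h a • X.ratRes h s :=
  (map_mul (X.ratRes h) (X.toRat U a) s).trans
    (congrArg (· * X.ratRes h s) (X.ratRes_toRat h a))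

variable {X}

/-- The sections on `U` of `ℒ(D) ⊆ 𝒦`: those `s ∈ 𝒦(U)` such that `s|_V ∈ f⁻¹ 𝒪_X(V)` whenever
`D|_V` is represented by `f ∈ 𝒦^×(V)`, `V ≤ U`. If `D` is represented by `{(U_i, f_i)}`, this is the
subsheaf of `𝒦` with `ℒ(D)|_{U_i} = f_i⁻¹ 𝒪_X|_{U_i}`. -/
def lineSheafSec (D : X.CartierDivisor) (U : Opens X) : Submodule (X.Sec U) (X.RatSec U) where
  carrier := {s | ∀ (V : Opens X) (h : V ≤ U) (f : (X.RatSec V)ˣ),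
    X.divOf V (Additive.ofMul f) = X.divRes le_top D →
      ∃ a : X.Sec V, X.ratRes h s = (f⁻¹ : (X.RatSec V)ˣ) * X.toRat V a}
  zero_mem' V h f _ := ⟨0, by rw [map_zero, map_zero, mul_zero]⟩
  add_mem' hs ht V h f hf := by
    obtain ⟨a, ha⟩ := hs V h f hf
    obtain ⟨b, hb⟩ := ht V h f hf
    exact ⟨a + b, by rw [map_add, map_add, ha, hb, mul_add]⟩
  smul_mem' c s hs V h f hf := by
    obtain ⟨a, ha⟩ := hs V h f hf
    refine ⟨X.res h c * a, ?_⟩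
    rw [X.ratRes_smul, ha, map_mul]
    exact mul_left_comm _ _ _

/-- Restriction of sections of `ℒ(D)`. -/
def lineSheafRes (D : X.CartierDivisor) {U V : Opens X} (h : V ≤ U) :
    lineSheafSec D U →+ lineSheafSec D V where
  toFun s := ⟨X.ratRes h s.1, fun W h' f hf => s.2 W (h'.trans h) f hf⟩
  map_zero' := rfl
  map_add' _ _ := rfl

/-- The `𝒪_X`-module `ℒ(D)`. -/
def lineSheaf (D : X.CartierDivisor) : OMod X :=
  OMod.ofRes (fun U => lineSheafSec D U) (lineSheafRes D) (fun _ _ => rfl) (fun _ _ _ => rfl)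
    (fun h a s => Subtype.ext (X.ratRes_smul h a s.1))

end SemiringedSpace

end

/-!
# Cartier divisors and invertible sheaves on a cancellative semiring scheme

Let `η` be the generic point of `X` and `K = 𝒪_{X,η}`. Two facts about a cancellative semiring
scheme are used. Since `X` is irreducible, a section of `𝒦` on an open set is determined by its
value at `η`. Moreover `𝒪_X → 𝒦` is injective (`SemiringScheme.genericGermInjective`): locally two
sections are fractions `a / b` and `c / d` on an open subset of some `Spec A`, and if they agree
at `η`, then `e * (d * a) = e * (b * c)` for some `e` outside the prime ideal `η`; this `e` is a
nonzero section, so it can be cancelled. Everything else is formal and holds whenever `𝒪_X → 𝒦` is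
injective (`SemiringedSpace.GenericGermInjective`).

The argument compares invertible sheaves through homomorphisms `ψ : L → 𝒦` (`RatHom`) which map
`L|_U` isomorphically onto `f⁻¹ 𝒪_X|_U` (`RatHom.IsIsoOnto`), for `f ∈ 𝒦ˣ(U)`. Such an `f` is
determined up to units of `𝒪_X` (`RatHom.IsIsoOnto.div_eq`), so the local choices of `f` glue to a
Cartier divisor `D`, and then `ψ` is an isomorphism of `L` onto `ℒ(D)` if `L` is a sheaf
(`RatHom.nonempty_iso_lineSheaf`). The theorem follows by choosing suitable homomorphisms to `𝒦`:
* the inclusion `ℒ(D) ⊆ 𝒦` is locally an isomorphism onto `f⁻¹ 𝒪_X`, so `ℒ(D)` is invertible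
  (`lineSheaf_isInvertible`);
* multiplication in `𝒦`, extended to the sheafified tensor product, gives `ℒ(D) ⊗ ℒ(E) ≅ ℒ(D + E)`
  (`nonempty_tensor_lineSheaf_iso`);
* a trivialization of an invertible sheaf `L` near `η` identifies `L_η` with `K` and gives `L →
  𝒦`, whence surjectivity (`OMod.IsInvertible.exists_iso_lineSheaf`);
* two homomorphisms `ℒ(D) → 𝒦` that are locally embeddings differ by a factor in `Kˣ`, so `ℒ(D) ≅
  ℒ(E)` if and only if `E - D` is principal (`nonempty_lineSheaf_iso_iff`), which is both the
  well-definedness and the injectivity of the map on classes.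
-/

open scoped TensorProduct

/-! ### Gluing of sections -/

namespace SemiringedSpace

lemma eq_of_locally_eq (X : SemiringedSpace.{u}) {U : Opens X} {s t : X.Sec U}
    (h : ∀ x ∈ U, ∃ (V : Opens X) (hV : V ≤ U), x ∈ V ∧ X.res hV s = X.res hV t) : s = t := by
  choose V hV hx e using fun x : U => h x.1 x.2
  exact TopCat.Sheaf.eq_of_locally_eq' X.sheaf V U (fun x => homOfLE (hV x))
    (fun x hx' => Opens.mem_iSup.2 ⟨⟨x, hx'⟩, hx ⟨x, hx'⟩⟩) s t e

lemma exists_gluing (X : SemiringedSpace.{u}) {U : Opens X} {V : U → Opens X}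
    (hV : ∀ x, V x ≤ U) (hx : ∀ x, x.1 ∈ V x) (s : ∀ x, X.Sec (V x))
    (hs : ∀ x y, X.res inf_le_left (s x) = X.res (inf_le_right : V x ⊓ V y ≤ V y) (s y)) :
    ∃ t : X.Sec U, ∀ x, X.res (hV x) t = s x :=
  (TopCat.Sheaf.existsUnique_gluing' X.sheaf V U (fun x => homOfLE (hV x))
    (fun x hx' => Opens.mem_iSup.2 ⟨⟨x, hx'⟩, hx ⟨x, hx'⟩⟩) s hs).exists

end SemiringedSpace

/-! ### Affine charts and germs at the generic point -/

/-- An open subset of `X` isomorphic to `Spec A`, described through the correspondence `W ↦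
toOpens W` between open subsets of `Spec A` and open subsets of the chart, and the isomorphisms
`𝒪(W) ≃ 𝒪_X(toOpens W)`. The homeomorphism itself enters only through `exists_opens`
and `exists_point`. -/
structure AffineChart (X : SemiringedSpace.{u}) where
  A : CommSemiRingCat.{u}
  toOpens : Opens (SemiringSpec A) → Opens X
  mono : Monotone toOpens
  equiv : ∀ W, (SemiringSpec A).Sec W ≃+* X.Sec (toOpens W)
  res_equiv : ∀ {V W} (h : W ≤ V) (s : (SemiringSpec A).Sec V),
    X.res (mono h) (equiv V s) = equiv W ((SemiringSpec A).res h s)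
  exists_opens : ∀ V : Opens X, ∃ W, toOpens W = V ⊓ toOpens ⊤
  exists_point : ∀ y ∈ toOpens ⊤, ∃ p : SemiringSpec A, ∀ W, y ∈ toOpens W ↔ p ∈ W

open AlgebraicGeometry in
lemma SemiringScheme.exists_affineChart (X : SemiringScheme.{u}) (x : X.toSheafedSpace) :
    ∃ c : AffineChart X.toSheafedSpace, x ∈ c.toOpens ⊤ := by
  obtain ⟨U, hxU, A, ⟨i⟩⟩ := X.locally_affine x
  let f := i.hom
  have hc : IsIso f.hom.c := inferInstance
  have hmem : ∀ (W : Opens (SemiringSpec A)) (y : X.toSheafedSpace) (hy : y ∈ U),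
      y ∈ U.isOpenEmbedding.isOpenMap.functor.obj ((Opens.map f.hom.base).obj W) ↔
        f.hom.base ⟨y, hy⟩ ∈ W := by
    intro W y hy
    constructor
    · rintro ⟨z, hz, rfl⟩
      exact hz
    · intro h
      exact ⟨⟨y, hy⟩, h, rfl⟩
  have hle : ∀ W : Opens (SemiringSpec A),
      U.isOpenEmbedding.isOpenMap.functor.obj ((Opens.map f.hom.base).obj W) ≤ U := by
    rintro W _ ⟨z, -, rfl⟩
    exact z.2
  refine ⟨{
    A := A
    toOpens := fun W => U.isOpenEmbedding.isOpenMap.functor.obj ((Opens.map f.hom.base).obj W)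
    mono := fun V W h => (U.isOpenEmbedding.isOpenMap.functor.map
      ((Opens.map f.hom.base).map (homOfLE h))).le
    equiv := fun W => (asIso (f.hom.c.app (op W))).commSemiRingCatIsoToRingEquiv
    res_equiv := fun {V W} h s =>
      (congrArg (fun g => g.hom s) (f.hom.c.naturality (homOfLE h).op)).symm
    exists_opens := fun V => ?_
    exists_point := ?_ }, (hmem ⊤ x hxU).2 trivial⟩
  · refine ⟨(Opens.map i.inv.hom.base).obj
      ((Opens.map (X.toSheafedSpace.ofRestrict U.isOpenEmbedding).hom.base).obj V), ?_⟩
    have hinv : ∀ (y : X.toSheafedSpace) (hy : y ∈ U),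
        (i.inv.hom.base (f.hom.base ⟨y, hy⟩) : U).1 = y := fun y hy =>
      congrArg Subtype.val (congrArg (fun g => g ⟨y, hy⟩)
        ((SheafedSpace.forget CommSemiRingCat.{u}).mapIso i).hom_inv_id)
    ext y
    constructor
    · intro h
      have hy := hle _ h
      refine ⟨?_, (hmem ⊤ y hy).2 trivial⟩
      exact Eq.mp (congrArg (· ∈ V) (hinv y hy)) ((hmem _ y hy).1 h)
    · rintro ⟨h1, h2⟩
      have hy := hle _ h2
      exact (hmem _ y hy).2 (Eq.mpr (congrArg (· ∈ V) (hinv y hy)) h1)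
  · intro y h
    exact ⟨f.hom.base ⟨y, hle _ h⟩, fun W => hmem W y _⟩

namespace SemiringSpec

variable {A : CommSemiRingCat.{u}}

/-- The section `a / 1` on `W`. -/
noncomputable def const (W : Opens (TopCat.of (PrimeSpectrum A))) : A →+* sections A W where
  toFun a := ⟨fun p => algebraMap A (Loc A p.1) a,
    TopCat.PrelocalPredicate.sheafifyOf (P := isFraction A)
      ⟨a, 1, fun p => ⟨p.1.asIdeal.primeCompl.one_mem, rfl⟩⟩⟩
  map_zero' := Subtype.ext (funext fun p => map_zero (algebraMap A (Loc A p.1)))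
  map_one' := Subtype.ext (funext fun p => map_one (algebraMap A (Loc A p.1)))
  map_add' a b := Subtype.ext (funext fun p => map_add (algebraMap A (Loc A p.1)) a b)
  map_mul' a b := Subtype.ext (funext fun p => map_mul (algebraMap A (Loc A p.1)) a b)

/-- If the semirings of sections are cancellative, then sections of `Spec A` with the same
germ at `q` agree near every point all of whose neighbourhoods contain `q`: if `a / b` and `c / d`
agree at `q`, then `e * (a * d) = e * (c * b)` for some `e` outside the prime ideal `q`, and `e`
is a nonzero section, which can be cancelled. -/
lemma exists_res_eq_of_cancellative
    (hA : ∀ W, IsCancellativeSemiring ((SemiringSpec A).Sec W)) {p q : SemiringSpec A}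
    (hpq : ∀ W : Opens (SemiringSpec A), p ∈ W → q ∈ W) {V N : Opens (SemiringSpec A)}
    (hp : p ∈ V) (hN : N ≤ V) (hq : q ∈ N) (s t : (SemiringSpec A).Sec V)
    (h : (SemiringSpec A).res hN s = (SemiringSpec A).res hN t) :
    ∃ (W : Opens (SemiringSpec A)) (hW : W ≤ V), p ∈ W ∧
      (SemiringSpec A).res hW s = (SemiringSpec A).res hW t := by
  obtain ⟨W₁, h₁, i₁, a, b, hab⟩ := s.2 ⟨p, hp⟩
  obtain ⟨W₂, h₂, i₂, c, d, hcd⟩ := t.2 ⟨p, hp⟩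
  let W : Opens (SemiringSpec A) := W₁ ⊓ W₂
  have hpW : p ∈ W := ⟨h₁, h₂⟩
  refine ⟨W, inf_le_left.trans i₁.le, hpW, ?_⟩
  have hqW := hpq W hpW
  obtain ⟨hb, hab'⟩ := hab ⟨q, hqW.1⟩
  obtain ⟨hd, hcd'⟩ := hcd ⟨q, hqW.2⟩
  have hst : s.1 ⟨q, hN hq⟩ = t.1 ⟨q, hN hq⟩ := congrFun (congrArg Subtype.val h) ⟨q, hq⟩
  have hloc : Localization.mk a ⟨b, hb⟩ = Localization.mk c ⟨d, hd⟩ :=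
    hab'.symm.trans (hst.trans hcd')
  rw [Localization.mk_eq_mk_iff, Localization.r_iff_exists] at hloc
  obtain ⟨⟨e, he⟩, hloc⟩ := hloc
  have hprime : ∀ r : SemiringSpec A, r.asIdeal.IsPrime := fun r => PrimeSpectrum.isPrime (R := A) r
  have he0 : const W e ≠ 0 := by
    intro h0
    have h0 : algebraMap A (Loc A q) e = 0 := congrFun (congrArg Subtype.val h0) ⟨q, hqW⟩
    rw [IsLocalization.map_eq_zero_iff q.asIdeal.primeCompl] at h0
    obtain ⟨⟨m, hm⟩, h0⟩ := h0
    exact q.asIdeal.primeCompl.mul_mem hm he (by rw [h0]; exact q.asIdeal.zero_mem)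
  have key : const W (d * a) = const W (b * c) := by
    refine hA W _ he0 _ _ ?_
    refine ((map_mul (const W) (d * a) e).symm.trans (congrArg (const W) ?_)).trans
      (map_mul (const W) (b * c) e)
    rw [mul_comm _ e, mul_comm _ e]
    exact hloc
  refine Subtype.ext (funext fun r => ?_)
  obtain ⟨hb, hab'⟩ := hab ⟨r.1, r.2.1⟩
  obtain ⟨hd, hcd'⟩ := hcd ⟨r.1, r.2.2⟩
  refine hab'.trans (Eq.trans ?_ hcd'.symm)
  have hr : algebraMap A (Loc A r.1) (d * a) = algebraMap A (Loc A r.1) (b * c) :=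
    congrFun (congrArg Subtype.val key) r
  rw [IsLocalization.eq_iff_exists r.1.asIdeal.primeCompl] at hr
  rw [Localization.mk_eq_mk_iff, Localization.r_iff_exists]
  exact hr

end SemiringSpec

namespace SemiringedSpace

/-- Sections are determined by their germs at the generic point: `𝒪_X → 𝒦` is injective. -/
class GenericGermInjective (X : SemiringedSpace.{u}) [IrreducibleSpace X] [QuasiSober X] :
    Prop where
  injective : ∀ (U : Opens X) (hU : genericPoint X ∈ U), Function.Injective (X.germ U hU)

end SemiringedSpace

open SemiringedSpace in
instance SemiringScheme.genericGermInjective (X : SemiringScheme.{u}) [X.IsCancellative]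
    [Nonempty X.toSheafedSpace] : GenericGermInjective X.toSheafedSpace where
  injective U hU s t hst := by
    refine eq_of_locally_eq _ fun x hx => ?_
    obtain ⟨c, hc⟩ := X.exists_affineChart x
    obtain ⟨V, hV⟩ := c.exists_opens U
    have hVU : c.toOpens V ≤ U := hV.le.trans inf_le_left
    have hxV : x ∈ c.toOpens V := hV.ge ⟨hx, hc⟩
    obtain ⟨p, hp⟩ := c.exists_point x hc
    have hη : ∀ W : Opens X.toSheafedSpace, x ∈ W → genericPoint X.toSheafedSpace ∈ W :=
      fun W h => genericPoint_mem ⟨x, h⟩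
    obtain ⟨q, hq⟩ := c.exists_point _ (hη _ hc)
    have hcanc : ∀ W, IsCancellativeSemiring ((SemiringSpec c.A).Sec W) := by
      intro W a ha b d hbd
      apply (c.equiv W).injective
      refine IsCancellative.cancel (X := X) _ (c.equiv W a) ?_ _ _ ?_
      · rwa [Ne, EmbeddingLike.map_eq_zero_iff]
      · rw [← map_mul, ← map_mul, hbd]
    obtain ⟨N, hN, hηN, e⟩ := (germ_eq_iff _ _ s t).1 hst
    obtain ⟨M, hM⟩ := c.exists_opens N
    let M' := M ⊓ V
    have hM' : c.toOpens M' ≤ N := (c.mono inf_le_left).trans (hM.le.trans inf_le_left)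
    obtain ⟨W, hW, hpW, hres⟩ := SemiringSpec.exists_res_eq_of_cancellative hcanc (p := p) (q := q)
      (fun W h => (hq W).1 (hη _ ((hp W).2 h))) ((hp V).1 hxV) (inf_le_right : M' ≤ V)
      ⟨(hq M).1 (hM.ge ⟨hηN, hη _ hc⟩), (hq V).1 (hη _ hxV)⟩
      ((c.equiv V).symm (res _ hVU s)) ((c.equiv V).symm (res _ hVU t)) (by
        apply (c.equiv M').injective
        rw [← c.res_equiv, ← c.res_equiv, RingEquiv.apply_symm_apply, RingEquiv.apply_symm_apply,
          res_res, res_res, ← res_res _ hN hM', ← res_res _ hN hM', e])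
    refine ⟨c.toOpens W, (c.mono hW).trans hVU, (hp W).2 hpW, ?_⟩
    have := congrArg (c.equiv W) hres
    rwa [← c.res_equiv, ← c.res_equiv, RingEquiv.apply_symm_apply, RingEquiv.apply_symm_apply,
          res_res, res_res] at this

/-! ### Rational functions on an irreducible space -/

namespace SemiringedSpace

section Rat

variable {X : SemiringedSpace.{u}} [IrreducibleSpace X] [QuasiSober X] {U V : Opens X}

/-- The value at the generic point of a section of `𝒦`. -/
noncomputable def ratVal (hU : genericPoint X ∈ U) : X.RatSec U →+* X.FunctionField where
  toFun s := DFunLike.coe (F := LocallyConstant U X.FunctionField) s ⟨_, hU⟩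
  map_zero' := rfl
  map_one' := rfl
  map_add' _ _ := rfl
  map_mul' _ _ := rfl

/-- A locally constant function takes its value at `x` on a neighbourhood of `x`, which contains the
generic point; so a section of `𝒦` is determined by its value there. -/
lemma ratSec_ext {s t : X.RatSec U}
    (h : ∀ hU : genericPoint X ∈ U, ratVal hU s = ratVal hU t) : s = t := by
  have key : ∀ (s : LocallyConstant U X.FunctionField) (x : U),
      s x = s ⟨_, genericPoint_mem x⟩ := by
    intro s x
    have hx : x.1 ∈ (⟨_, U.2.isOpenMap_subtype_val _ (s.isLocallyConstant {s x})⟩ : Opens X) :=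
      ⟨x, rfl, rfl⟩
    obtain ⟨y, hy, e⟩ := genericPoint_mem ⟨_, hx⟩
    have : y = ⟨_, genericPoint_mem x⟩ := Subtype.ext e
    exact this ▸ hy.symm
  exact LocallyConstant.ext fun x => (key s x).trans ((h (genericPoint_mem x)).trans (key t x).symm)

lemma ratVal_res (h : V ≤ U) (hV : genericPoint X ∈ V) (s : X.RatSec U) :
    ratVal hV (X.ratRes h s) = ratVal (h hV) s := rfl

lemma ratVal_toRat (hU : genericPoint X ∈ U) (s : X.Sec U) :
    ratVal hU (X.toRat U s) = X.germ U hU s := rfl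

lemma ratVal_const (hU : genericPoint X ∈ U) (k : X.FunctionField) :
    ratVal hU (X.ratConst U k) = k := rfl

lemma ratRes_res {W : Opens X} (h : V ≤ U) (h' : W ≤ V) (s : X.RatSec U) :
    X.ratRes h' (X.ratRes h s) = X.ratRes (h'.trans h) s := rfl

lemma ratSec_smul_def (a : X.Sec U) (s : X.RatSec U) : a • s = X.toRat U a * s := rfl

lemma ratSec_eq_of_locally_eq {s t : X.RatSec U}
    (h : ∀ x ∈ U, ∃ (V : Opens X) (hV : V ≤ U), x ∈ V ∧ X.ratRes hV s = X.ratRes hV t) :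
    s = t := by
  refine ratSec_ext fun hU => ?_
  obtain ⟨V, hV, hη, e⟩ := h _ hU
  exact congrArg (ratVal hη) e

section Injective

variable [GenericGermInjective X]

lemma toRat_injective (U : Opens X) : Function.Injective (X.toRat U) := by
  intro s t h
  refine eq_of_locally_eq X fun x hx => ⟨U, le_rfl, hx, congrArg _ ?_⟩
  exact GenericGermInjective.injective U (genericPoint_mem ⟨x, hx⟩)
    (congrArg (ratVal (genericPoint_mem ⟨x, hx⟩)) h)

/-- `𝒪_X` is a subsheaf of `𝒦`: being a section of `𝒪_X` is a local condition. -/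
lemma mem_range_toRat_of_locally {s : X.RatSec U}
    (h : ∀ x ∈ U, ∃ (V : Opens X) (hV : V ≤ U), x ∈ V ∧ ∃ a, X.ratRes hV s = X.toRat V a) :
    ∃ a, s = X.toRat U a := by
  choose V hV hx a ha using fun x : U => h x.1 x.2
  obtain ⟨b, hb⟩ := X.exists_gluing hV hx a fun x y => by
    apply toRat_injective
    rw [← ratRes_toRat, ← ratRes_toRat, ← ha, ← ha, ratRes_res, ratRes_res]
  refine ⟨b, ratSec_eq_of_locally_eq fun x hx' => ⟨V ⟨x, hx'⟩, hV _, hx ⟨x, hx'⟩, ?_⟩⟩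
  rw [ratRes_toRat, hb, ha]

end Injective

/-- Restriction `𝒦^×(U) → 𝒦^×(V)`. -/
noncomputable abbrev ratUnitsRes (h : V ≤ U) : (X.RatSec U)ˣ →* (X.RatSec V)ˣ :=
  Units.map (X.ratRes h).toMonoidHom

lemma mem_unitsRange_of_locally [GenericGermInjective X] {f : (X.RatSec U)ˣ}
    (h : ∀ x ∈ U, ∃ (V : Opens X) (hV : V ≤ U), x ∈ V ∧ ratUnitsRes hV f ∈ X.unitsRange V) :
    f ∈ X.unitsRange U := by
  obtain ⟨a, ha⟩ := mem_range_toRat_of_locally (s := f.1) fun x hx => by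
    obtain ⟨V, hV, hxV, b, hb⟩ := h x hx
    exact ⟨V, hV, hxV, b.1, (congrArg Units.val hb).symm⟩
  obtain ⟨b, hb⟩ := mem_range_toRat_of_locally (s := f⁻¹.1) fun x hx => by
    obtain ⟨V, hV, hxV, b, hb⟩ := h x hx
    exact ⟨V, hV, hxV, b⁻¹.1, (congrArg (fun g => (g⁻¹).1) hb).symm⟩
  have hab : a * b = 1 := toRat_injective U (by rw [map_mul, ← ha, ← hb, map_one, Units.mul_inv])
  exact ⟨⟨a, b, hab, (mul_comm _ _).trans hab⟩, Units.ext ha.symm⟩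

end Rat

/-! ### Sections of `𝒦^× / 𝒪_X^×` -/

section Div

variable {X : SemiringedSpace.{u}} [IrreducibleSpace X] [QuasiSober X] {U V : Opens X}

/-- The divisor of `f ∈ 𝒦^×(U)`. -/
noncomputable abbrev div (f : (X.RatSec U)ˣ) : X.DivSec U := X.divOf U (Additive.ofMul f)

lemma div_mul (f g : (X.RatSec U)ˣ) : div (f * g) = div f + div g :=
  map_add (X.divOf U) (Additive.ofMul f) (Additive.ofMul g)

lemma divRes_div (h : V ≤ U) (f : (X.RatSec U)ˣ) :
    X.divRes h (div f) = div (ratUnitsRes h f) :=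
  (congrArg (fun g => g.hom (Additive.ofMul (QuotientGroup.mk (s := X.unitsRange U) f)))
    ((toSheafify (Opens.grothendieckTopology X) X.unitsQuotPresheaf).naturality
      (homOfLE h).op)).symm

lemma divRes_res {W : Opens X} (h : V ≤ U) (h' : W ≤ V) (D : X.DivSec U) :
    X.divRes h' (X.divRes h D) = X.divRes (h'.trans h) D :=
  (congrArg (fun f => f.hom D)
    (X.unitsQuotSheaf.obj.map_comp (homOfLE h).op (homOfLE h').op)).symm

lemma div_res_eq {W : Opens X} {D : X.DivSec W} {hU : U ≤ W} {f : (X.RatSec U)ˣ}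
    (hf : div f = X.divRes hU D) (h : V ≤ U) :
    div (ratUnitsRes h f) = X.divRes (h.trans hU) D := by
  rw [← divRes_div, hf, divRes_res]

lemma div_eq_of_locally_eq {D E : X.DivSec U}
    (h : ∀ x ∈ U, ∃ (V : Opens X) (hV : V ≤ U), x ∈ V ∧ X.divRes hV D = X.divRes hV E) :
    D = E := by
  choose V hV hx e using fun x : U => h x.1 x.2
  exact TopCat.Sheaf.eq_of_locally_eq' X.unitsQuotSheaf V U (fun x => homOfLE (hV x))
    (fun x hx' => Opens.mem_iSup.2 ⟨⟨x, hx'⟩, hx ⟨x, hx'⟩⟩) D E e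

lemma exists_div_gluing {V : U → Opens X}
    (hV : ∀ x, V x ≤ U) (hx : ∀ x, x.1 ∈ V x) (D : ∀ x, X.DivSec (V x))
    (hD : ∀ x y, X.divRes inf_le_left (D x) = X.divRes (inf_le_right : V x ⊓ V y ≤ V y) (D y)) :
    ∃ E : X.DivSec U, ∀ x, X.divRes (hV x) E = D x :=
  (TopCat.Sheaf.existsUnique_gluing' X.unitsQuotSheaf V U (fun x => homOfLE (hV x))
    (fun x hx' => Opens.mem_iSup.2 ⟨⟨x, hx'⟩, hx ⟨x, hx'⟩⟩) D hD).exists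

lemma exists_local_div (D : X.DivSec U) {x : X} (hx : x ∈ U) :
    ∃ (V : Opens X) (hV : V ≤ U), x ∈ V ∧ ∃ f, div f = X.divRes hV D := by
  obtain ⟨V, i, ⟨q, hq⟩, hxV⟩ := Presheaf.imageSieve_mem (Opens.grothendieckTopology X)
    (toSheafify (Opens.grothendieckTopology X) X.unitsQuotPresheaf) D x hx
  obtain ⟨f, rfl⟩ := QuotientGroup.mk_surjective q
  exact ⟨V, i.le, hxV, f, hq⟩

lemma div_eq_div_iff [GenericGermInjective X] {f g : (X.RatSec U)ˣ} :
    div f = div g ↔ ∃ a : (X.Sec U)ˣ, g.1 = f.1 * X.toRat U a := by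
  constructor
  · intro h
    have h' := Presheaf.equalizerSieve_mem (Opens.grothendieckTopology X)
      (toSheafify (Opens.grothendieckTopology X) X.unitsQuotPresheaf)
      (X := op U) (Additive.ofMul (QuotientGroup.mk (s := X.unitsRange U) f))
      (Additive.ofMul (QuotientGroup.mk (s := X.unitsRange U) g)) h
    obtain ⟨a, ha⟩ : f⁻¹ * g ∈ X.unitsRange U := mem_unitsRange_of_locally fun x hx => by
      obtain ⟨V, i, e, hxV⟩ := h' x hx
      refine ⟨V, i.le, hxV, ?_⟩
      have := QuotientGroup.eq.1 (show QuotientGroup.mk (s := X.unitsRange V) (ratUnitsRes i.le f) =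
        QuotientGroup.mk (ratUnitsRes i.le g) from e)
      rwa [← map_inv, ← map_mul] at this
    refine ⟨a, ?_⟩
    rw [eq_inv_mul_iff_mul_eq] at ha
    exact (congrArg Units.val ha).symm
  · rintro ⟨a, h⟩
    have : f⁻¹ * g ∈ X.unitsRange U := ⟨a, by
      rw [eq_inv_mul_iff_mul_eq]; exact Units.ext h.symm⟩
    exact congrArg (fun q => ((toSheafify (Opens.grothendieckTopology X)
      X.unitsQuotPresheaf).app (op U)).hom (Additive.ofMul q)) (QuotientGroup.eq.2 this)

end Div

end SemiringedSpace

/-! ### The sheaf of a Cartier divisor -/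

namespace OMod

variable {X : SemiringedSpace.{u}}

lemma IsSheaf.eq_of_locally_eq {L : OMod X} (hL : L.IsSheaf) {U : Opens X} {s t : L.Sec U}
    (h : ∀ x ∈ U, ∃ (V : Opens X) (hV : V ≤ U), x ∈ V ∧ L.res hV s = L.res hV t) : s = t := by
  choose V hV hx e using fun x : U => h x.1 x.2
  exact TopCat.Sheaf.eq_of_locally_eq' ⟨L.presheaf, hL⟩ V U (fun x => homOfLE (hV x))
    (fun x hx' => Opens.mem_iSup.2 ⟨⟨x, hx'⟩, hx ⟨x, hx'⟩⟩) s t e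

lemma IsSheaf.exists_gluing {L : OMod X} (hL : L.IsSheaf) {U : Opens X} {V : U → Opens X}
    (hV : ∀ x, V x ≤ U) (hx : ∀ x, x.1 ∈ V x) (s : ∀ x, L.Sec (V x))
    (hs : ∀ x y, L.res inf_le_left (s x) = L.res (inf_le_right : V x ⊓ V y ≤ V y) (s y)) :
    ∃ t : L.Sec U, ∀ x, L.res (hV x) t = s x :=
  (TopCat.Sheaf.existsUnique_gluing' ⟨L.presheaf, hL⟩ V U (fun x => homOfLE (hV x))
    (fun x hx' => Opens.mem_iSup.2 ⟨⟨x, hx'⟩, hx ⟨x, hx'⟩⟩) s hs).exists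

end OMod

namespace SemiringedSpace

variable {X : SemiringedSpace.{u}} [IrreducibleSpace X] [QuasiSober X] {U V : Opens X}

variable [GenericGermInjective X]

/-- It suffices to test membership in `ℒ(D)` against one local equation of `D` around each point. -/
lemma mem_lineSheafSec_of_locally {D : X.CartierDivisor} {s : X.RatSec U}
    (h : ∀ x ∈ U, ∃ (V : Opens X) (hV : V ≤ U), x ∈ V ∧ ∃ f, div f = X.divRes le_top D ∧
      ∃ a, X.ratRes hV s = f⁻¹.1 * X.toRat V a) : s ∈ lineSheafSec D U := by
  intro W hW g hg
  obtain ⟨a, ha⟩ : ∃ a, g.1 * X.ratRes hW s = X.toRat W a := by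
    refine mem_range_toRat_of_locally fun x hx => ?_
    obtain ⟨V, hV, hxV, f, hf, a, ha⟩ := h x (hW hx)
    have hfg : div (ratUnitsRes (inf_le_left : V ⊓ W ≤ V) f) =
        div (ratUnitsRes (inf_le_right : V ⊓ W ≤ W) g) :=
      (div_res_eq hf _).trans (div_res_eq hg _).symm
    obtain ⟨b, hb⟩ := div_eq_div_iff.1 hfg
    refine ⟨V ⊓ W, inf_le_right, ⟨hxV, hx⟩, b.1 * X.res inf_le_left a, ?_⟩
    have hs : X.ratRes (inf_le_right : V ⊓ W ≤ W) (X.ratRes hW s) =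
        X.ratRes inf_le_left f⁻¹.1 * X.toRat _ (X.res inf_le_left a) := by
      rw [← ratRes_toRat, ← map_mul, ← ha, ratRes_res, ratRes_res]
    have hg' : X.ratRes (inf_le_right : V ⊓ W ≤ W) g.1 =
        X.ratRes inf_le_left f.1 * X.toRat _ b := hb
    rw [map_mul, hs, hg', map_mul, mul_mul_mul_comm, ← map_mul, Units.mul_inv, map_one, one_mul]
  exact ⟨a, by rw [← ha, Units.inv_mul_cancel_left]⟩

/-- A homomorphism of `𝒪_X`-modules `L → 𝒦`. -/
structure RatHom (L : OMod X) where
  app : ∀ U, L.Sec U →ₗ[X.Sec U] X.RatSec U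
  naturality : ∀ {U V : Opens X} (h : V ≤ U) (m : L.Sec U),
    X.ratRes h (app U m) = app V (L.res h m)

/-- `ψ : L → 𝒦` maps `L|_U` isomorphically onto `f⁻¹ 𝒪_X|_U`. -/
structure RatHom.IsIsoOnto {L : OMod X} (ψ : RatHom L) (f : (X.RatSec U)ˣ) : Prop where
  injective : ∀ V ≤ U, Function.Injective (ψ.app V)
  range : ∀ (V : Opens X) (h : V ≤ U) (s : X.RatSec V),
    (∃ m, ψ.app V m = s) ↔ ∃ a, s = X.ratRes h f⁻¹.1 * X.toRat V a

/-- The inclusion `ℒ(D) ⊆ 𝒦`. -/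
noncomputable def lineSheafIncl (D : X.CartierDivisor) : RatHom (lineSheaf D) where
  app U := (lineSheafSec D U).subtype
  naturality _ _ := rfl

/-- If `D` is given by `f` on `U`, then `ℒ(D)|_U = f⁻¹ 𝒪_X|_U`. -/
lemma lineSheafIncl_isIsoOnto {D : X.CartierDivisor} {f : (X.RatSec U)ˣ}
    (hf : div f = X.divRes le_top D) : (lineSheafIncl D).IsIsoOnto f where
  injective V _ := Subtype.val_injective
  range V h s := by
    have hf' := div_res_eq hf h
    constructor
    · rintro ⟨m, rfl⟩
      exact m.2 V le_rfl (ratUnitsRes h f) hf'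
    · intro ⟨a, ha⟩
      exact ⟨⟨s, mem_lineSheafSec_of_locally fun x hx =>
        ⟨V, le_rfl, hx, ratUnitsRes h f, hf', a, ha⟩⟩, rfl⟩

lemma lineSheaf_isSheaf (D : X.CartierDivisor) : (lineSheaf D).IsSheaf := by
  refine (TopCat.Presheaf.isSheaf_iff_isSheafUniqueGluing _).2 fun ι U s hs => ?_
  have hcomp : ∀ i j (hi : genericPoint X ∈ U i) (hj : genericPoint X ∈ U j),
      ratVal hi (s i).1 = ratVal hj (s j).1 := fun i j hi hj =>
    congrArg (fun t => ratVal (U := U i ⊓ U j) ⟨hi, hj⟩ t.1) (hs i j)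
  -- the sections `s i` glue to the constant `k`,
  -- the common value of the `s i` at the generic point, if some `U i` is nonempty
  obtain ⟨k, hk⟩ : ∃ k : X.FunctionField,
      ∀ i (hi : genericPoint X ∈ U i), ratVal hi (s i).1 = k := by
    by_cases h : ∃ i, genericPoint X ∈ U i
    · obtain ⟨i, hi⟩ := h
      exact ⟨_, fun j hj => hcomp j i hj hi⟩
    · exact ⟨0, fun i hi => (h ⟨i, hi⟩).elim⟩
  have hres : ∀ i, X.ratRes (le_iSup U i) (X.ratConst _ k) = (s i).1 := fun i =>
    ratSec_ext fun hi => (hk i hi).symm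
  refine ⟨⟨X.ratConst _ k, mem_lineSheafSec_of_locally fun x hx => ?_⟩, fun i =>
    Subtype.ext (hres i), fun t ht => Subtype.ext (ratSec_eq_of_locally_eq fun x hx => ?_)⟩
  · obtain ⟨i, hi⟩ := Opens.mem_iSup.1 hx
    obtain ⟨V, hV, hxV, f, hf⟩ := exists_local_div (X.divRes (le_top (a := U i)) D) hi
    rw [divRes_res] at hf
    obtain ⟨a, ha⟩ := (s i).2 V hV f hf
    exact ⟨V, hV.trans (le_iSup U i), hxV, f, hf, a, by rw [← ha, ← hres, ratRes_res]⟩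
  · obtain ⟨i, hi⟩ := Opens.mem_iSup.1 hx
    exact ⟨U i, le_iSup U i, hi, (congrArg Subtype.val (ht i)).trans (hres i).symm⟩

/-- Multiplication by `f⁻¹` is an isomorphism `𝒪_X|_U ≅ L|_U` if `L|_U` is identified with
`f⁻¹ 𝒪_X|_U`. -/
lemma RatHom.IsIsoOnto.exists_isoOn {L : OMod X} {ψ : RatHom L} {f : (X.RatSec U)ˣ}
    (h : ψ.IsIsoOnto f) : ∃ e : OMod.IsoOn U (OMod.unit X) L, ∀ (V : Opens X) (hV : V ≤ U)
      (a : X.Sec V), ψ.app V (e.app V hV a) = X.ratRes hV f⁻¹.1 * X.toRat V a := by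
  choose g hg using fun (V : Opens X) (hV : V ≤ U) (a : X.Sec V) =>
    (h.range V hV (X.ratRes hV f⁻¹.1 * X.toRat V a)).2 ⟨a, rfl⟩
  have hinv : ∀ (V : Opens X) (hV : V ≤ U), X.ratRes hV f.1 * X.ratRes hV f⁻¹.1 = 1 :=
    fun V hV => by rw [← map_mul, Units.mul_inv, map_one]
  let g' : ∀ (V : Opens X) (hV : V ≤ U), X.Sec V →ₗ[X.Sec V] L.Sec V := fun V hV =>
    { toFun := g V hV
      map_add' := fun a b => h.injective V hV (by rw [map_add, hg, hg, hg, map_add, mul_add])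
      map_smul' := fun a b => h.injective V hV (by
        rw [LinearMap.map_smul, RingHom.id_apply, hg, hg, ratSec_smul_def, smul_eq_mul, map_mul,
          mul_left_comm]) }
  have hbij : ∀ V hV, Function.Bijective (g' V hV) := fun V hV => by
    constructor
    · intro a b hab
      have : X.ratRes hV f⁻¹.1 * X.toRat V a = X.ratRes hV f⁻¹.1 * X.toRat V b := by
        rw [← hg, ← hg]; exact congrArg _ hab
      apply toRat_injective
      rw [← one_mul (X.toRat V a), ← one_mul (X.toRat V b), ← hinv V hV, mul_assoc, this, mul_assoc]
    · intro m
      obtain ⟨a, ha⟩ := (h.range V hV _).1 ⟨m, rfl⟩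
      exact ⟨a, h.injective V hV ((hg V hV a).trans ha.symm)⟩
  refine ⟨⟨fun V hV => LinearEquiv.ofBijective (g' V hV) (hbij V hV), fun {V W} hV hW a =>
    h.injective W (hW.trans hV) ?_⟩, fun V hV a => hg V hV a⟩
  refine (ψ.naturality hW (g V hV a)).symm.trans (Eq.trans ?_ (hg W (hW.trans hV) _).symm)
  change X.Sec V at a
  rw [show ψ.app V (g V hV a) = _ from hg V hV a, map_mul, ratRes_toRat, ratRes_res]
  rfl

lemma lineSheaf_isInvertible (D : X.CartierDivisor) : (lineSheaf D).IsInvertible where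
  isSheaf := lineSheaf_isSheaf D
  locally_unit x := by
    obtain ⟨U, hU, hx, f, hf⟩ := exists_local_div D (U := ⊤) (x := x) trivial
    obtain ⟨e, -⟩ := (lineSheafIncl_isIsoOnto hf).exists_isoOn
    exact ⟨U, hx, ⟨e.symm⟩⟩

/-- An `𝒪_X`-module `L` with a homomorphism `L → 𝒦` which is locally an isomorphism onto
`f⁻¹ 𝒪_X`, for local equations `f` of `D`, is isomorphic to `ℒ(D)` if it is a sheaf. -/
lemma RatHom.nonempty_iso_lineSheaf {L : OMod X} (hL : L.IsSheaf) (ψ : RatHom L)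
    (D : X.CartierDivisor)
    (h : ∀ x : X, ∃ U : Opens X, x ∈ U ∧ ∃ f : (X.RatSec U)ˣ, div f = X.divRes le_top D ∧
      ψ.IsIsoOnto f) : Nonempty (OMod.Iso L (lineSheaf D)) := by
  choose U hxU f hf hψ using h
  have hinj : ∀ V, Function.Injective (ψ.app V) := fun V m n hmn =>
    hL.eq_of_locally_eq fun x hx => ⟨V ⊓ U x, inf_le_left, ⟨hx, hxU x⟩,
      (hψ x).injective _ inf_le_right (by rw [← ψ.naturality, ← ψ.naturality, hmn])⟩
  have hmem : ∀ V m, ψ.app V m ∈ lineSheafSec D V := fun V m =>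
    mem_lineSheafSec_of_locally fun x hx => by
      obtain ⟨a, ha⟩ := ((hψ x).range (V ⊓ U x) inf_le_right _).1
        ⟨L.res inf_le_left m, (ψ.naturality _ m).symm⟩
      exact ⟨V ⊓ U x, inf_le_left, ⟨hx, hxU x⟩, ratUnitsRes inf_le_right (f x),
        div_res_eq (hf x) _, a, ha⟩
  have hsurj : ∀ V, ∀ s ∈ lineSheafSec D V, ∃ m, ψ.app V m = s := by
    intro V s hs
    have hloc : ∀ x : V, ∃ m, ψ.app (V ⊓ U x) m = X.ratRes inf_le_left s := fun x =>
      ((hψ x).range _ inf_le_right _).2 (hs _ inf_le_left (ratUnitsRes inf_le_right (f x))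
        (div_res_eq (hf x) _))
    choose m hm using hloc
    obtain ⟨t, ht⟩ := hL.exists_gluing (fun x : V => (inf_le_left : V ⊓ U x ≤ V))
      (fun x => ⟨x.2, hxU x⟩) m (fun x y => hinj _ (by
        rw [← ψ.naturality, ← ψ.naturality, hm, hm, ratRes_res, ratRes_res]))
    refine ⟨t, ratSec_eq_of_locally_eq fun x hx => ⟨V ⊓ U x, inf_le_left, ⟨hx, hxU x⟩, ?_⟩⟩
    rw [ψ.naturality, ht ⟨x, hx⟩]
    exact hm ⟨x, hx⟩
  exact ⟨⟨fun V _ => LinearEquiv.ofBijective ((ψ.app V).codRestrict (lineSheafSec D V) (hmem V))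
    ⟨fun m n h => hinj V (congrArg Subtype.val h), fun s => by
      obtain ⟨m, hm⟩ := hsurj V s.1 s.2
      exact ⟨m, Subtype.ext hm⟩⟩, fun _ h m => Subtype.ext (ψ.naturality h m)⟩⟩

end SemiringedSpace

/-! ### Homomorphisms to the sheaf of rational functions -/

namespace OMod

lemma IsoOn.unit_app {X : SemiringedSpace.{u}} {U V : Opens X} {L : OMod X}
    (e : IsoOn U (unit X) L) (hV : V ≤ U) (a : X.Sec V) :
    e.app V hV a = a • L.res hV (e.app U le_rfl (1 : X.Sec U)) := by
  have h : L.res hV (e.app U le_rfl (1 : X.Sec U)) = e.app V hV (X.res hV 1) :=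
    e.naturality le_rfl hV (1 : X.Sec U)
  rw [h, map_one]
  refine Eq.trans (congrArg (e.app V hV) (mul_one a).symm) ?_
  exact (e.app V hV).map_smul a (1 : X.Sec V)

end OMod

namespace SemiringedSpace

variable {X : SemiringedSpace.{u}} [IrreducibleSpace X] [QuasiSober X] {U V : Opens X}

namespace RatHom

variable {L L' : OMod X}

/-- A homomorphism `L → 𝒦`, given by its values at the generic point. -/
noncomputable def ofVal (L : OMod X) (g : ∀ U, genericPoint X ∈ U → L.Sec U → X.FunctionField)
    (add : ∀ U hU m n, g U hU (m + n) = g U hU m + g U hU n)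
    (smul : ∀ U hU (a : X.Sec U) m, g U hU (a • m) = ratVal hU (X.toRat U a) * g U hU m)
    (res : ∀ (U V : Opens X) (h : V ≤ U) hV m, g V hV (L.res h m) = g U (h hV) m) : RatHom L where
  app U :=
    { toFun := fun m => (⟨fun x => g U (genericPoint_mem x) m, IsLocallyConstant.of_constant _
        fun _ _ => rfl⟩ : LocallyConstant U X.FunctionField)
      map_add' := fun m n => LocallyConstant.ext fun x => add U (genericPoint_mem x) m n
      map_smul' := fun a m => LocallyConstant.ext fun x => smul U (genericPoint_mem x) a m }
  naturality h m := LocallyConstant.ext fun x => (res _ _ h (genericPoint_mem x) m).symm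

/-- The composition of `ψ : L' → 𝒦` with an isomorphism `L ≅ L'`. -/
noncomputable def compIso (ψ : RatHom L') (e : OMod.Iso L L') : RatHom L where
  app U := ψ.app U ∘ₗ (e.app U le_top).toLinearMap
  naturality {U V} h m := (ψ.naturality h (e.app U le_top m)).trans
    (congrArg (ψ.app V) (e.naturality le_top h m))

/-- The homomorphism `κ ψ` for `κ ∈ K`. -/
noncomputable def scale (κ : X.FunctionField) (ψ : RatHom L) : RatHom L where
  app U :=
    { toFun := fun m => X.ratConst U κ * ψ.app U m
      map_add' := fun m n => by rw [map_add, mul_add]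
      map_smul' := fun a m => by
        rw [LinearMap.map_smul, RingHom.id_apply, ratSec_smul_def, ratSec_smul_def, mul_left_comm] }
  naturality h m := by
    refine (map_mul (X.ratRes h) _ _).trans ?_
    rw [ψ.naturality]
    rfl

lemma scale_app (κ : X.FunctionField) (ψ : RatHom L) (m : L.Sec U) :
    (ψ.scale κ).app U m = X.ratConst U κ * ψ.app U m := rfl

/-- The product `m ⊗ n ↦ ψ m * ψ' n`, on the presheaf tensor product. -/
noncomputable def tensorPresheaf (ψ : RatHom L) (ψ' : RatHom L') :
    RatHom (OMod.tensorPresheaf L L') where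
  app U := TensorProduct.lift (LinearMap.mk₂ (X.Sec U) (fun m n => ψ.app U m * ψ'.app U n)
    (fun m m' n => by rw [map_add, add_mul])
    (fun a m n => by rw [LinearMap.map_smul, ratSec_smul_def, ratSec_smul_def, mul_assoc])
    (fun m n n' => by rw [map_add, mul_add])
    (fun a m n => by rw [LinearMap.map_smul, ratSec_smul_def, ratSec_smul_def, mul_left_comm]))
  naturality {U V} h s := by
    change L.Sec U ⊗[X.Sec U] L'.Sec U at s
    change X.ratRes h (TensorProduct.lift _ s) = TensorProduct.lift _ (OMod.tensorRes L L' h s)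
    induction s using TensorProduct.induction_on with
    | zero => simp only [map_zero]
    | add s t hs ht => simp only [map_add, hs, ht]
    | tmul m n =>
      rw [OMod.tensorRes_tmul, TensorProduct.lift.tmul, TensorProduct.lift.tmul]
      refine (map_mul (X.ratRes h) _ _).trans ?_
      rw [ψ.naturality, ψ'.naturality]
      rfl

lemma tensorPresheaf_app_tmul (ψ : RatHom L) (ψ' : RatHom L') (m : L.Sec U) (n : L'.Sec U) :
    (ψ.tensorPresheaf ψ').app U (m ⊗ₜ[X.Sec U] n : L.Sec U ⊗[X.Sec U] L'.Sec U) =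
      ψ.app U m * ψ'.app U n := rfl

/-- The map `L_η → K` induced by `L → 𝒦`. -/
noncomputable def stalkVal (ψ : RatHom L) : L.Stalk (genericPoint X) → X.FunctionField :=
  DirectLimit.lift (fun _ _ h => L.res (NhdIndex.opens_le h))
    (fun (W : NhdIndex (genericPoint X)) m => ratVal (OrderDual.ofDual W).2 (ψ.app W.opens m))
    (fun W W' h m => by
      rw [← ψ.naturality]
      rfl)

lemma stalkVal_germ (ψ : RatHom L) (hU : genericPoint X ∈ U) (m : L.Sec U) :
    ψ.stalkVal (L.germ U hU m) = ratVal hU (ψ.app U m) := rfl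

/-- The extension of `ψ : L → 𝒦` to the sheafification of `L`: a family of germs is sent to the
image in `K` of its member at the generic point. -/
noncomputable def sheafify (ψ : RatHom L) : RatHom (OMod.sheafify L) :=
  ofVal _ (fun U hU s => ψ.stalkVal (Subtype.val (p := (· ∈ OMod.sheafifySec L U)) s ⟨_, hU⟩))
    (fun U hU s t => by
      change ψ.stalkVal (s.1 ⟨_, hU⟩ + t.1 ⟨_, hU⟩) = _
      generalize s.1 ⟨_, hU⟩ = z, t.1 ⟨_, hU⟩ = w
      obtain ⟨V, hV, hη, m, rfl⟩ := L.exists_germ_eq_le z hU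
      obtain ⟨W, hW, hη', n, rfl⟩ := L.exists_germ_eq_le w hη
      rw [← L.germ_res hW hη', ← map_add, stalkVal_germ, stalkVal_germ, stalkVal_germ, map_add,
        map_add])
    (fun U hU a s => by
      change ψ.stalkVal (X.germ U hU a • s.1 ⟨_, hU⟩) = _
      generalize s.1 ⟨_, hU⟩ = z
      obtain ⟨V, hV, hη, m, rfl⟩ := L.exists_germ_eq_le z hU
      rw [← X.germ_res hV hη, ← OMod.germ_smul, stalkVal_germ, stalkVal_germ, LinearMap.map_smul,
        ratSec_smul_def, map_mul, ratVal_toRat]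
      exact congrArg (· * _) (X.germ_res hV hη a))
    (fun _ _ _ _ _ => rfl)

lemma sheafify_toSheafify (ψ : RatHom L) (m : L.Sec U) :
    ψ.sheafify.app U (OMod.toSheafify L U m) = ψ.app U m :=
  ratSec_ext fun _ => rfl

namespace IsIsoOnto

variable {ψ : RatHom L} {ψ' : RatHom L'} {f g : (X.RatSec U)ˣ}

lemma res (h : ψ.IsIsoOnto f) (hV : V ≤ U) : ψ.IsIsoOnto (ratUnitsRes hV f) where
  injective W hW := h.injective W (hW.trans hV)
  range W hW := h.range W (hW.trans hV)

lemma of_isoOn [GenericGermInjective X] (e : OMod.IsoOn U (OMod.unit X) L)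
    (he : ∀ (V : Opens X) (hV : V ≤ U) (a : X.Sec V),
      ψ.app V (e.app V hV a) = X.ratRes hV f⁻¹.1 * X.toRat V a) : ψ.IsIsoOnto f where
  injective V hV m n hmn := by
    obtain ⟨a, rfl⟩ := (e.app V hV).surjective m
    obtain ⟨b, rfl⟩ := (e.app V hV).surjective n
    change X.Sec V at a b
    rw [he, he] at hmn
    exact congrArg _ (toRat_injective V ((f⁻¹.isUnit.map (X.ratRes hV)).mul_left_cancel hmn))
  range V hV s := by
    constructor
    · rintro ⟨m, rfl⟩
      obtain ⟨a, rfl⟩ := (e.app V hV).surjective m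
      exact ⟨a, he V hV a⟩
    · rintro ⟨a, rfl⟩
      exact ⟨_, he V hV a⟩

/-- `f` is determined by `f⁻¹ 𝒪_X` up to units of `𝒪_X`. -/
lemma div_eq [GenericGermInjective X] (hf : ψ.IsIsoOnto f) (hg : ψ.IsIsoOnto g) :
    div f = div g := by
  have aux : ∀ {f g : (X.RatSec U)ˣ}, ψ.IsIsoOnto f → ψ.IsIsoOnto g →
      ∃ a, g.1 * f⁻¹.1 = X.toRat U a := by
    intro f g hf hg
    obtain ⟨a, ha⟩ := (hg.range U le_rfl f⁻¹.1).1
      ((hf.range U le_rfl f⁻¹.1).2 ⟨1, by rw [map_one, mul_one]; rfl⟩)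
    exact ⟨a, by rw [ha]; exact Units.mul_inv_cancel_left g _⟩
  obtain ⟨a, ha⟩ := aux hf hg
  obtain ⟨b, hb⟩ := aux hg hf
  have hab : a * b = 1 := toRat_injective U (by
    rw [map_mul, ← ha, ← hb, map_one, mul_assoc, Units.inv_mul_cancel_left, Units.mul_inv])
  exact div_eq_div_iff.2 ⟨⟨a, b, hab, (mul_comm _ _).trans hab⟩, by
    rw [← ha, mul_left_comm, Units.mul_inv, mul_one]⟩

lemma compIso (h : ψ'.IsIsoOnto g) (e : OMod.Iso L L') : (ψ'.compIso e).IsIsoOnto g where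
  injective V hV := (h.injective V hV).comp (e.app V le_top).injective
  range V hV s := (e.app V le_top).surjective.exists.symm.trans (h.range V hV s)

lemma scale (h : ψ.IsIsoOnto f) (κ : X.FunctionFieldˣ) :
    (ψ.scale κ.1).IsIsoOnto (Units.map (X.ratConst U).toMonoidHom κ⁻¹ * f) := by
  have hunit : ∀ V, X.ratConst V κ.1 * X.ratConst V κ⁻¹.1 = 1 := fun V => by
    rw [← map_mul, Units.mul_inv, map_one]
  have hinv : ∀ (V : Opens X) (hV : V ≤ U),
      X.ratRes hV (Units.map (X.ratConst U).toMonoidHom κ⁻¹ * f)⁻¹.1 =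
        X.ratConst V κ.1 * X.ratRes hV f⁻¹.1 := fun V hV => by
    rw [mul_inv, Units.val_mul, map_mul]
    rfl
  refine ⟨fun V hV m n hmn => h.injective V hV
    ((IsUnit.of_mul_eq_one _ (hunit V)).mul_left_cancel hmn), fun V hV s => ?_⟩
  rw [hinv V hV]
  constructor
  · rintro ⟨m, rfl⟩
    obtain ⟨a, ha⟩ := (h.range V hV _).1 ⟨m, rfl⟩
    exact ⟨a, by rw [scale_app, ha, mul_assoc]⟩
  · rintro ⟨a, rfl⟩
    obtain ⟨m, hm⟩ := (h.range V hV _).2 ⟨a, rfl⟩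
    exact ⟨m, by rw [scale_app, hm, mul_assoc]⟩

lemma tensorPresheaf [GenericGermInjective X] (h : ψ.IsIsoOnto f) (h' : ψ'.IsIsoOnto g) :
    (ψ.tensorPresheaf ψ').IsIsoOnto (f * g) := by
  obtain ⟨e, he⟩ := h.exists_isoOn
  obtain ⟨e', he'⟩ := h'.exists_isoOn
  refine of_isoOn ((OMod.tensorUnit U).symm.trans (e.tensorPresheaf e')) fun V hV a => ?_
  have : ((OMod.tensorUnit U).symm.trans (e.tensorPresheaf e')).app V hV a =
      (e.app V hV (1 : X.Sec V) ⊗ₜ[X.Sec V] e'.app V hV a : L.Sec V ⊗[X.Sec V] L'.Sec V) := rfl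
  rw [this, tensorPresheaf_app_tmul, he V hV (1 : X.Sec V), he', map_one, mul_one, mul_inv,
    Units.val_mul, map_mul, mul_assoc]

lemma sheafify [GenericGermInjective X] (h : ψ.IsIsoOnto f) : ψ.sheafify.IsIsoOnto f where
  injective V hV s t hst := by
    change OMod.sheafifySec L V at s t
    refine Subtype.ext (funext fun x => ?_)
    obtain ⟨W, hW, i, m, hm⟩ := s.2 x
    obtain ⟨W', hW', i', n, hn⟩ := t.2 x
    have hmn : L.res (inf_le_left : W ⊓ W' ≤ W) m = L.res inf_le_right n := by
      refine h.injective _ (inf_le_left.trans (i.le.trans hV)) (ratSec_ext fun hη => ?_)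
      rw [← stalkVal_germ, ← stalkVal_germ, L.germ_res, L.germ_res]
      have h1 := hm ⟨_, hη.1⟩
      have h2 := hn ⟨_, hη.2⟩
      exact (congrArg ψ.stalkVal h1).symm.trans
        ((congrArg (ratVal (i.le hη.1)) hst).trans (congrArg ψ.stalkVal h2))
    refine (hm ⟨x, hW⟩).trans (Eq.trans ?_ (hn ⟨x, hW'⟩).symm)
    have hx : x.1 ∈ W ⊓ W' := ⟨hW, hW'⟩
    exact (L.germ_res inf_le_left hx m).symm.trans
      ((congrArg _ hmn).trans (L.germ_res inf_le_right hx n))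
  range V hV s := by
    constructor
    · rintro ⟨s, rfl⟩
      change OMod.sheafifySec L V at s
      obtain ⟨a, ha⟩ : ∃ a, X.ratRes hV f.1 * ψ.sheafify.app V s = X.toRat V a := by
        refine mem_range_toRat_of_locally fun x hx => ?_
        obtain ⟨W, hW, i, m, hm⟩ := s.2 ⟨x, hx⟩
        obtain ⟨a, ha⟩ := (h.range W (i.le.trans hV) _).1 ⟨m, rfl⟩
        have hs : X.ratRes i.le (ψ.sheafify.app V s) = ψ.app W m :=
          ratSec_ext fun hη => congrArg ψ.stalkVal (hm ⟨_, hη⟩)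
        refine ⟨W, i.le, hW, a, ?_⟩
        rw [map_mul, hs, ha, ratRes_res, ← mul_assoc, ← map_mul, Units.mul_inv, map_one, one_mul]
      refine ⟨a, ?_⟩
      rw [← ha, ← mul_assoc, ← map_mul, Units.inv_mul, map_one, one_mul]
    · rintro ⟨a, rfl⟩
      obtain ⟨m, hm⟩ := (h.range V hV _).2 ⟨a, rfl⟩
      exact ⟨OMod.toSheafify L V m, (ψ.sheafify_toSheafify m).trans hm⟩

/-- Two homomorphisms to `𝒦` differ by an element of `K` if the first is an embedding near the
generic point. -/
lemma exists_eq_scale [GenericGermInjective X] (hU : genericPoint X ∈ U) (h : ψ.IsIsoOnto f)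
    (χ : RatHom L) : ∃ k : X.FunctionField, ∀ V m, χ.app V m = X.ratConst V k * ψ.app V m := by
  obtain ⟨e, he⟩ := h.exists_isoOn
  -- the generator `e 1` of `L|_U` has `ψ (e 1) = f⁻¹`, so the factor has to be `f * χ (e 1)`
  refine ⟨ratVal hU (f.1 * χ.app U (e.app U le_rfl (1 : X.Sec U))), fun V m =>
    ratSec_ext fun hV => ?_⟩
  have hη : genericPoint X ∈ V ⊓ U := ⟨hV, hU⟩
  obtain ⟨a, ha⟩ := (e.app (V ⊓ U) inf_le_right).surjective (L.res inf_le_left m)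
  change X.Sec (V ⊓ U) at a
  have ha' : a • L.res inf_le_right (e.app U le_rfl (1 : X.Sec U)) = L.res inf_le_left m := by
    rw [← ha]
    exact (e.unit_app inf_le_right a).symm
  have h1 : X.ratRes inf_le_left (χ.app V m) =
      X.toRat _ a * X.ratRes inf_le_right (χ.app U (e.app U le_rfl (1 : X.Sec U))) := by
    rw [χ.naturality, χ.naturality, ← ha', LinearMap.map_smul, ratSec_smul_def]
  have h2 : X.ratRes inf_le_left (ψ.app V m) = X.ratRes inf_le_right f⁻¹.1 * X.toRat _ a := by
    rw [ψ.naturality, ← ha, he]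
  have h3 := congrArg (ratVal hη) h1
  have h4 := congrArg (ratVal hη) h2
  rw [ratVal_res, map_mul, ratVal_res] at h3 h4
  have h5 : ratVal hU f.1 * ratVal hU f⁻¹.1 = 1 := by rw [← map_mul, Units.mul_inv, map_one]
  rw [map_mul, ratVal_const, h3, h4, map_mul, mul_mul_mul_comm, h5, one_mul, mul_comm]

end IsIsoOnto

/-- An `𝒪_X`-module embedded into `𝒦` as an invertible sheaf is the sheaf of a Cartier divisor:
its local generators have inverses that are the local equations of the divisor. -/
lemma exists_iso_lineSheaf [GenericGermInjective X] (hL : L.IsSheaf) (ψ : RatHom L)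
    (h : ∀ x : X, ∃ U : Opens X, x ∈ U ∧ ∃ f : (X.RatSec U)ˣ, ψ.IsIsoOnto f) :
    ∃ D : X.CartierDivisor, Nonempty (OMod.Iso L (lineSheaf D)) := by
  choose U hx f hf using h
  obtain ⟨D, hD⟩ := exists_div_gluing (U := ⊤) (V := fun x => U x.1) (fun _ => le_top)
    (fun x => hx x.1) (fun x => div (f x.1)) fun x y => by
      rw [divRes_div, divRes_div]
      exact ((hf x.1).res inf_le_left).div_eq ((hf y.1).res inf_le_right)
  exact ⟨D, ψ.nonempty_iso_lineSheaf hL D fun x =>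
    ⟨U x, hx x, f x, (hD ⟨x, trivial⟩).symm, hf x⟩⟩

end RatHom

end SemiringedSpace

/-! ### Divisor classes and invertible sheaves -/

namespace SemiringedSpace

variable {X : SemiringedSpace.{u}} [IrreducibleSpace X] [QuasiSober X]

section

variable {L : OMod X} {U₀ : Opens X}

/-- The homomorphism `L → 𝒦` induced by a trivialization of `L` near the generic point `η`,
through the isomorphism of `L_η` and `K`. -/
noncomputable def ratHomOfTrivialization (hU₀ : genericPoint X ∈ U₀)
    (e : OMod.IsoOn U₀ L (OMod.unit X)) : RatHom L :=
  RatHom.ofVal L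
    (fun U hU m => ratVal (Opens.mem_inf.2 ⟨hU, hU₀⟩)
      (X.toRat (U ⊓ U₀) (e.app (U ⊓ U₀) inf_le_right (L.res inf_le_left m))))
    (fun U hU m n => by
      rw [map_add, map_add]
      exact (congrArg _ (map_add (X.toRat (U ⊓ U₀)) _ _)).trans (map_add _ _ _))
    (fun U hU a m => by
      rw [L.res_smul, LinearEquiv.map_smul]
      refine (congrArg _ (map_mul (X.toRat (U ⊓ U₀)) _ _)).trans ((map_mul _ _ _).trans ?_)
      rw [← ratRes_toRat]
      rfl)
    (fun U V h hV m => by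
      have h' : V ⊓ U₀ ≤ U ⊓ U₀ := inf_le_inf_right _ h
      have key : X.res h' (e.app (U ⊓ U₀) inf_le_right (L.res inf_le_left m)) =
          e.app (V ⊓ U₀) inf_le_right (L.res inf_le_left (L.res h m)) :=
        (e.naturality inf_le_right h' (L.res inf_le_left m)).trans (by rw [L.res_res, L.res_res])
      rw [← ratVal_res h' (Opens.mem_inf.2 ⟨hV, hU₀⟩)]
      exact congrArg _ ((congrArg (X.toRat _) key).symm.trans (ratRes_toRat X h' _).symm))

/-- On any open set where `L` is trivial, the two trivializations differ by a unit of `𝒪_X` near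
`η`, hence by an element of `Kˣ`. -/
lemma ratHomOfTrivialization_exists_isIsoOnto [GenericGermInjective X] (hU₀ : genericPoint X ∈ U₀)
    (e₀ : OMod.IsoOn U₀ L (OMod.unit X)) {U : Opens X} (hU : genericPoint X ∈ U)
    (e : OMod.IsoOn U (OMod.unit X) L) :
    ∃ f : (X.RatSec U)ˣ, (ratHomOfTrivialization hU₀ e₀).IsIsoOnto f := by
  let W := U ⊓ U₀
  have hη : genericPoint X ∈ W := ⟨hU, hU₀⟩
  let g : OMod.IsoOn W (OMod.unit X) (OMod.unit X) :=
    (e.restrict inf_le_left).trans (e₀.restrict inf_le_right)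
  let b : X.Sec W := g.app W le_rfl (1 : X.Sec W)
  let c : X.Sec W := g.symm.app W le_rfl (1 : X.Sec W)
  have hmul : ∀ {h : OMod.IsoOn W (OMod.unit X) (OMod.unit X)} (a : X.Sec W),
      h.app W le_rfl a = a * (show X.Sec W from h.app W le_rfl (1 : X.Sec W)) := fun {h} a =>
    (h.unit_app le_rfl a).trans (congrArg (a * ·) (OMod.res_self _ _ _))
  have hcb : c * b = 1 := (hmul c).symm.trans ((g.app W le_rfl).apply_symm_apply _)
  let k : X.FunctionFieldˣ := ⟨ratVal hη (X.toRat W c), ratVal hη (X.toRat W b),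
    by rw [← map_mul, ← map_mul, hcb, map_one, map_one],
    by rw [← map_mul, ← map_mul, mul_comm, hcb, map_one, map_one]⟩
  refine ⟨Units.map (X.ratConst U).toMonoidHom k, RatHom.IsIsoOnto.of_isoOn e fun V hV a =>
    ratSec_ext fun hV' => ?_⟩
  change ratVal (Opens.mem_inf.2 ⟨hV', hU₀⟩) (X.toRat (V ⊓ U₀) (e₀.app (V ⊓ U₀) inf_le_right
    (L.res inf_le_left (e.app V hV a)))) = ratVal hη (X.toRat W b) * ratVal hV' (X.toRat V a)
  have hW : V ⊓ U₀ ≤ W := inf_le_inf_right _ hV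
  have key : e₀.app (V ⊓ U₀) inf_le_right (L.res inf_le_left (e.app V hV a)) =
      X.res inf_le_left a * X.res hW b := by
    have h1 : L.res inf_le_left (e.app V hV a) = e.app (V ⊓ U₀) (inf_le_left.trans hV)
        (X.res (inf_le_left : V ⊓ U₀ ≤ V) a) := e.naturality hV inf_le_left a
    rw [h1]
    exact g.unit_app hW (X.res (inf_le_left : V ⊓ U₀ ≤ V) a)
  refine (congrArg (fun z => ratVal (Opens.mem_inf.2 ⟨hV', hU₀⟩) (X.toRat (V ⊓ U₀) z)) key).trans
    ((congrArg (ratVal _) (map_mul (X.toRat (V ⊓ U₀)) _ _)).trans ?_)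
  rw [map_mul, ← ratRes_toRat, ← ratRes_toRat, mul_comm]
  rfl

end

/-- The principal divisor of `κ ∈ Kˣ`. -/
noncomputable abbrev principalDiv (κ : X.FunctionFieldˣ) : X.CartierDivisor :=
  div (Units.map (X.ratConst ⊤).toMonoidHom κ)

lemma divRes_principalDiv (U : Opens X) (κ : X.FunctionFieldˣ) :
    X.divRes le_top (principalDiv κ) = div (Units.map (X.ratConst U).toMonoidHom κ) :=
  divRes_div le_top _

variable [GenericGermInjective X]

/-- Every invertible sheaf is isomorphic to some `ℒ(D)`. -/
lemma _root_.OMod.IsInvertible.exists_iso_lineSheaf {L : OMod X} (hL : L.IsInvertible) :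
    ∃ D : X.CartierDivisor, Nonempty (OMod.Iso L (lineSheaf D)) := by
  obtain ⟨U₀, hU₀, ⟨e₀⟩⟩ := hL.locally_unit (genericPoint X)
  refine RatHom.exists_iso_lineSheaf hL.isSheaf (ratHomOfTrivialization hU₀ e₀) fun x => ?_
  obtain ⟨U, hx, ⟨e⟩⟩ := hL.locally_unit x
  exact ⟨U, hx, ratHomOfTrivialization_exists_isIsoOnto hU₀ e₀ (genericPoint_mem ⟨x, hx⟩) e.symm⟩

/-- `ℒ(D) ⊗ ℒ(E) ≅ ℒ(D + E)`, by multiplication in `𝒦`. -/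
lemma nonempty_tensor_lineSheaf_iso (D E : X.CartierDivisor) :
    Nonempty (OMod.Iso (OMod.tensor (lineSheaf D) (lineSheaf E)) (lineSheaf (D + E))) := by
  refine RatHom.nonempty_iso_lineSheaf (OMod.sheafify_isSheaf _)
    ((lineSheafIncl D).tensorPresheaf (lineSheafIncl E)).sheafify _ fun x => ?_
  obtain ⟨U, hU, hx, f, hf⟩ := exists_local_div D (U := ⊤) (x := x) trivial
  obtain ⟨V, hV, hxV, g, hg⟩ := exists_local_div E (U := ⊤) (x := x) trivial
  have hf' := div_res_eq hf (inf_le_left : U ⊓ V ≤ U)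
  have hg' := div_res_eq hg (inf_le_right : U ⊓ V ≤ V)
  exact ⟨U ⊓ V, ⟨hx, hxV⟩, _, by rw [div_mul, hf', hg', map_add],
    ((lineSheafIncl_isIsoOnto hf').tensorPresheaf (lineSheafIncl_isIsoOnto hg')).sheafify⟩

/-- `ℒ(D) ≅ ℒ(E)` if and only if `D` and `E` differ by a principal divisor: an isomorphism
`ℒ(D) ≅ ℒ(E)` is the multiplication by an element of `Kˣ`. -/
lemma nonempty_lineSheaf_iso_iff (D E : X.CartierDivisor) :
    Nonempty (OMod.Iso (lineSheaf D) (lineSheaf E)) ↔ -D + E ∈ X.principalDivisors := by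
  constructor
  · rintro ⟨e⟩
    let ψ := lineSheafIncl D
    let χ := (lineSheafIncl E).compIso e
    have hloc : ∀ x : X, ∃ U : Opens X, x ∈ U ∧ ∃ f g : (X.RatSec U)ˣ,
        div f = X.divRes le_top D ∧ div g = X.divRes le_top E ∧ ψ.IsIsoOnto f ∧ χ.IsIsoOnto g := by
      intro x
      obtain ⟨U, hU, hx, f, hf⟩ := exists_local_div D (U := ⊤) (x := x) trivial
      obtain ⟨V, hV, hxV, g, hg⟩ := exists_local_div E (U := ⊤) (x := x) trivial
      have hf' := div_res_eq hf (inf_le_left : U ⊓ V ≤ U)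
      have hg' := div_res_eq hg (inf_le_right : U ⊓ V ≤ V)
      exact ⟨U ⊓ V, ⟨hx, hxV⟩, _, _, hf', hg', lineSheafIncl_isIsoOnto hf',
        (lineSheafIncl_isIsoOnto hg').compIso e⟩
    obtain ⟨U, hU, f, g, -, -, hf, hg⟩ := hloc (genericPoint X)
    -- `χ = k ψ` and `ψ = l χ`; evaluation on the preimage of `f⁻¹` shows that `l * k = 1`
    obtain ⟨k, hk⟩ := hf.exists_eq_scale hU χ
    obtain ⟨l, hl⟩ := hg.exists_eq_scale hU ψ
    have hlk : l * k = 1 := by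
      obtain ⟨m, hm⟩ := (hf.range U le_rfl f⁻¹.1).2 ⟨1, by rw [map_one, mul_one]; rfl⟩
      have h := hl U m
      rw [hk, ← mul_assoc, hm] at h
      have h' := congrArg (ratVal hU) (congrArg (· * f.1) h)
      simp only [mul_assoc, Units.inv_mul, mul_one, map_one] at h'
      rw [← map_mul] at h'
      exact h'.symm
    let κ : X.FunctionFieldˣ := ⟨k, l, (mul_comm _ _).trans hlk, hlk⟩
    have hχ : χ = ψ.scale κ.1 := by
      obtain ⟨a, h⟩ := χ
      congr 1
      funext V
      exact LinearMap.ext fun m => hk V m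
    refine ⟨Additive.ofMul κ⁻¹, (div_eq_of_locally_eq fun x _ => ?_ :
      principalDiv κ⁻¹ = -D + E)⟩
    obtain ⟨V, hx, f, g, hf, hg, hψ, hχ'⟩ := hloc x
    rw [hχ] at hχ'
    have := hχ'.div_eq (hψ.scale κ)
    refine ⟨V, le_top, hx, ?_⟩
    rw [divRes_principalDiv, map_add, map_neg, ← hf, ← hg, this, div_mul, add_left_comm,
      neg_add_cancel, add_zero]
  · rintro ⟨κ, hκ⟩
    change principalDiv κ.toMul = -D + E at hκ
    refine RatHom.nonempty_iso_lineSheaf (lineSheaf_isSheaf D)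
      ((lineSheafIncl D).scale κ.toMul⁻¹.1) E fun x => ?_
    obtain ⟨U, hU, hx, f, hf⟩ := exists_local_div D (U := ⊤) (x := x) trivial
    refine ⟨U, hx, _, ?_, (lineSheafIncl_isIsoOnto hf).scale _⟩
    rw [div_mul, inv_inv, ← divRes_principalDiv, hκ, hf, ← map_add, add_comm, add_neg_cancel_left]

/-- The class of `ℒ(D)` in `Pic X`, for a divisor class `[D]`. -/
noncomputable def picOfClass : Multiplicative X.CaCl → Pic X := fun c =>
  Quotient.map' (s₁ := QuotientAddGroup.leftRel X.principalDivisors)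
    (fun D => ⟨lineSheaf D, lineSheaf_isInvertible D⟩)
    (fun D E h => (nonempty_lineSheaf_iso_iff D E).2 (QuotientAddGroup.leftRel_apply.1 h)) c.toAdd

lemma picOfClass_mk (D : X.CartierDivisor) :
    picOfClass (Multiplicative.ofAdd (QuotientAddGroup.mk D)) =
      Pic.mk (lineSheaf D) (lineSheaf_isInvertible D) := rfl

lemma picOfClass_bijective : Function.Bijective (picOfClass (X := X)) := by
  constructor
  · intro c d h
    obtain ⟨D, rfl⟩ := QuotientAddGroup.mk_surjective c
    obtain ⟨E, rfl⟩ := QuotientAddGroup.mk_surjective d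
    exact QuotientAddGroup.eq.2 ((nonempty_lineSheaf_iso_iff D E).1 (Quotient.exact h))
  · intro p
    obtain ⟨⟨L, hL⟩, rfl⟩ := Quotient.exists_rep p
    obtain ⟨D, ⟨e⟩⟩ := hL.exists_iso_lineSheaf
    exact ⟨Multiplicative.ofAdd (QuotientAddGroup.mk D), Quotient.sound ⟨e.symm⟩⟩

lemma picOfClass_mul (c d : Multiplicative X.CaCl) :
    picOfClass (c * d) = picOfClass c * picOfClass d := by
  obtain ⟨D, rfl⟩ := QuotientAddGroup.mk_surjective c
  obtain ⟨E, rfl⟩ := QuotientAddGroup.mk_surjective d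
  obtain ⟨e⟩ := nonempty_tensor_lineSheaf_iso D E
  exact Quotient.sound ⟨e.symm⟩

end SemiringedSpace

theorem proposition4p10 (X : SemiringScheme.{u}) [X.IsCancellative]
    [Nonempty X.toSheafedSpace] :
    ∃ φ : Multiplicative (SemiringedSpace.CaCl X.toSheafedSpace) ≃* Pic X.toSheafedSpace,
      ∀ D : SemiringedSpace.CartierDivisor X.toSheafedSpace,
        ∃ h : (SemiringedSpace.lineSheaf D).IsInvertible,
          φ (Multiplicative.ofAdd (QuotientAddGroup.mk D)) =
            Pic.mk (SemiringedSpace.lineSheaf D) h := by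
  exact ⟨MulEquiv.mk' (Equiv.ofBijective _ SemiringedSpace.picOfClass_bijective)
    SemiringedSpace.picOfClass_mul,
    fun D => ⟨SemiringedSpace.lineSheaf_isInvertible D, SemiringedSpace.picOfClass_mk D⟩⟩
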